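/- **Two-stage codes for the Z-channel.** All logarithms $\log$ are to base $2$, $\ln$ is the natural logarithm, and $h(p)=-p\log p-(1-p)\log(1-p)$ on $[0,1]$. For $x,y\in\{0,1\}^n$ let $\Delta(x,y)=\#\{i: x_i=1,\ y_i=0\}$ and $d_Z(x,y)=2\max(\Delta(x,y),\Delta(y,x))$. A two-stage code with $M$ messages and length $n=n_1+n_2$, $1<n_1<n$, consists of maps $f:[M]\to\{0,1\}^{n_1}$ and $g:[M]\times\{0,1\}^{n_1}\to\{0,1\}^{n_2}$. The possible outputs for message $m$ under at most $t$ asymmetric errors are the pairs $(y_1,y_2)\in\{0,1\}^{n_1}\times\{0,1\}^{n_2}$ with $y_1\le f(m)$, $y_2\le g(m,y_1)$ (coordinatewise) and $\Delta(f(m),y_1)+\Delta(g(m,y_1),y_2)\le t$. The code corrects $t$ errors if some decoder recovers $m$ from every possible output for $m$, for all $m\in[M]$. Let $M_Z^{(2)}(n,t)$ be the largest $M$ for which such a code correcting $t$ errors exists for some $n_1$ with $1<n_1<n$, and let $$R_Z^{(2)}(\tau)=\limsup_{n\to\infty}\frac{\log M_Z^{(2)}(n,\lfloor\tau n\rfloor)}{n}.$$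 For $M\ge 1$ let $\tau(M)$ be the supremum of all $\delta>0$ such that, for some $n\ge 1$, there is a code $\mathcal C\subset\{0,1\}^n$ of size $M$ with $d_Z(x,y)\ge 2n\delta$ for all distinct $x,y\in\mathcal C$ (thus $\tau(1)=+\infty$). For an integer $L\ge 0$, $\omega\in[0,1]$ and $s>0$ put $$Z(s,L,\omega)=\omega^{L+1}+(1-\omega)^{L+1}+\sum_{i=1}^{L}e^{-si/(L+1)}\binom{L+1}{i}\omega^i(1-\omega)^{L+1-i},\qquad g(s,L,\omega)=-\ln Z(s,L,\omega),$$ $$\delta(s,L,\omega)=\frac{1}{Z(s,L,\omega)}\sum_{i=1}^{L}e^{-si/(L+1)}\binom{L}{i-1}\omega^i(1-\omega)^{L+1-i},$$ and for real $R$ let $$\tau^*(R,L,\omega)=\sup\{\delta(s,L,\omega):\ s>0,\ g(s,L,\omega)-s\,\delta(s,L,\omega)\ge RL\ln 2\},\qquad \sup\emptyset=0.$$ For $0\le\alpha<1$ let $$R_2=R_2(\alpha,x,\omega,R)=\frac{\alpha(1-\omega+x)}{1-\alpha}\left(h\!\left(\frac{x}{1-\omega+x}\right)-h\!\left(\frac{1-\sqrt{\max\{0,\,1-4\tau^*(R,1,\omega)/(1-\omega+x)\}}}{2}\right)\right).$$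 **Theorem.** Let $0<\tau<1$ and let $L_{up}$ be a positive integer. Then $$R_Z^{(2)}(\tau)\ \ge\ \sup_{0\le\omega\le1}\ \sup_{0\le\alpha<1}\ \sup_{\substack{0\le R\le h(\omega)\\ \text{subject to }(*)}}\alpha R,$$ where $(*)$ means that for every $x\in(0,\min(\omega,\tau/\alpha))$ (with $\tau/0=+\infty$): 1. for every $L\in\{1,\dots,L_{up}\}$ with $\tau^*(R,L-1,\omega)\le x\le\tau^*(R,L,\omega)$, one has $\dfrac{\tau-\alpha x}{1-\alpha}\le\tau(L)$; 2. if $\tau^*(R,L_{up},\omega)\le x$, then $\dfrac{\tau-\alpha x}{1-\alpha}\le\tau^*(R_2,1,1/2)$. -/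

import Mathlib

namespace ZChannel

/-- `Delta x y` is the number of positions `i` with `x i = 1` and `y i = 0`. -/
def Delta {n : ℕ} (x y : Fin n → Bool) : ℕ :=
  (Finset.univ.filter fun i => x i = true ∧ y i = false).card

/-- The asymmetric distance `2 max (Δ(x,y), Δ(y,x))`. -/
def asymDist {n : ℕ} (x y : Fin n → Bool) : ℕ :=
  2 * max (Delta x y) (Delta y x)

/-- The possible channel outputs `(y₁, y₂)` for a two-stage encoder `(f, g)` and the message `m`,
when at most `t` errors occur in total. Errors only turn a `1` into a `0`, so `yᵢ` is
coordinatewise below the transmitted word; the second-stage word may depend on `m` and on the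
word `y₁` received in the first stage. -/
def outputs {n₁ n₂ M : ℕ} (f : Fin M → (Fin n₁ → Bool))
    (g : Fin M → (Fin n₁ → Bool) → (Fin n₂ → Bool)) (t : ℕ) (m : Fin M) :
    Set ((Fin n₁ → Bool) × (Fin n₂ → Bool)) :=
  {y | Delta y.1 (f m) = 0 ∧ Delta y.2 (g m y.1) = 0 ∧
    Delta (f m) y.1 + Delta (g m y.1) y.2 ≤ t}

/-- `M` messages can be transmitted with `n₁` channel uses in the first stage and `n₂` in the
second one against `t` errors: there are an encoder and a decoder that is always correct. -/
def TwoStageAchievable (n₁ n₂ t M : ℕ) : Prop :=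
  ∃ (f : Fin M → (Fin n₁ → Bool)) (g : Fin M → (Fin n₁ → Bool) → (Fin n₂ → Bool))
    (dec : (Fin n₁ → Bool) × (Fin n₂ → Bool) → Fin M),
    ∀ m : Fin M, ∀ y ∈ outputs f g t m, dec y = m

/-- The numbers of messages that can be transmitted with `n` channel uses against `t` errors,
the feedback moment `n₁` with `1 < n₁ < n` being chosen in advance. -/
def twoStageSizes (n t : ℕ) : Set ℕ :=
  {M | ∃ n₁ n₂ : ℕ, 1 < n₁ ∧ 0 < n₂ ∧ n₁ + n₂ = n ∧ TwoStageAchievable n₁ n₂ t M}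

theorem bddAbove_twoStageSizes (n t : ℕ) : BddAbove (twoStageSizes n t) := by
  refine ⟨2 ^ n, ?_⟩
  rintro M ⟨n₁, n₂, -, -, rfl, f, g, dec, hdec⟩
  have hinj : Function.Injective fun m : Fin M => (f m, g m (f m)) := by
    have key : ∀ m, dec (f m, g m (f m)) = m := fun m =>
      hdec m _ (by simp [outputs, Delta])
    intro a b hab
    have h := congrArg dec hab
    simpa only [key] using h
  have h := Fintype.card_le_of_injective _ hinj
  simpa [pow_add] using h

/-- The maximum number of messages in two-stage transmission. -/
noncomputable def twoStageMax (n t : ℕ) : ℕ := sSup (twoStageSizes n t)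

/-- The maximal asymptotic rate of two-stage error-correcting codes for the Z-channel. -/
noncomputable def twoStageRate (τ : ℝ) : EReal :=
  Filter.limsup
    (fun n : ℕ => ((Real.logb 2 (twoStageMax n ⌊τ * n⌋₊ : ℝ) / n : ℝ) : EReal)) Filter.atTop

/-- The maximal fraction `δ` such that some code of size `M` and some length `n` has minimal
asymmetric distance at least `2 n δ`. For `M = 1` there is no pair of distinct codewords and the
value is `⊤`. -/
noncomputable def maxFraction (M : ℕ) : EReal :=
  ⨆ δ ∈ {δ : ℝ | 0 < δ ∧ ∃ n : ℕ, 0 < n ∧ ∃ C : Finset (Fin n → Bool), C.card = M ∧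
    ∀ x ∈ C, ∀ y ∈ C, x ≠ y → 2 * (n : ℝ) * δ ≤ asymDist x y}, (δ : EReal)

/-- The binary entropy function, with logarithms to base `2`. -/
noncomputable def entropy (p : ℝ) : ℝ := Real.binEntropy p / Real.log 2

/-- `ω^(L+1) + (1-ω)^(L+1) + ∑_{i=1}^{L} exp(-s i/(L+1)) C(L+1,i) ω^i (1-ω)^(L+1-i)`. -/
noncomputable def partitionSum (s : ℝ) (L : ℕ) (ω : ℝ) : ℝ :=
  ω ^ (L + 1) + (1 - ω) ^ (L + 1) +
    ∑ i ∈ Finset.Icc 1 L, Real.exp (-(s * i / (L + 1))) * ((L + 1).choose i : ℝ) *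
      ω ^ i * (1 - ω) ^ (L + 1 - i)

noncomputable def gFun (s : ℝ) (L : ℕ) (ω : ℝ) : ℝ := -Real.log (partitionSum s L ω)

noncomputable def deltaFun (s : ℝ) (L : ℕ) (ω : ℝ) : ℝ :=
  (∑ i ∈ Finset.Icc 1 L, Real.exp (-(s * i / (L + 1))) * (L.choose (i - 1) : ℝ) *
      ω ^ i * (1 - ω) ^ (L + 1 - i)) / partitionSum s L ω

/-- `τ*(R, L, ω)`: the supremum of `δ(s, L, ω)` over all `s > 0` with
`g(s, L, ω) - s δ(s, L, ω) ≥ R L ln 2`. These values are nonnegative, and the supremum is `0`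
when no `s` is admissible. -/
noncomputable def tauStar (R : ℝ) (L : ℕ) (ω : ℝ) : ℝ :=
  sSup {d : ℝ | ∃ s : ℝ, 0 < s ∧
    R * L * Real.log 2 ≤ gFun s L ω - s * deltaFun s L ω ∧ d = deltaFun s L ω}

/-- The rate `R₂` of the second-stage code, for a fraction `x` of errors in the first stage.
The square root is read as `0` when its argument is negative (as `Real.sqrt` does). -/
noncomputable def secondRate (α x ω R : ℝ) : ℝ :=
  α * (1 - ω + x) / (1 - α) *
    (entropy (x / (1 - ω + x)) -
      entropy ((1 - Real.sqrt (1 - 4 * tauStar R 1 ω / (1 - ω + x))) / 2))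

/-- The condition `(*)`. The range `x < ω`, `α * x < τ` is `x < min (ω, τ / α)`, with
`τ / 0 = +∞`. -/
def Admissible (τ : ℝ) (Lup : ℕ) (ω α R : ℝ) : Prop :=
  ∀ x : ℝ, 0 < x → x < ω → α * x < τ →
    (∀ L ∈ Finset.Icc 1 Lup, tauStar R (L - 1) ω ≤ x → x ≤ tauStar R L ω →
      (((τ - α * x) / (1 - α) : ℝ) : EReal) ≤ maxFraction L) ∧
    (tauStar R Lup ω ≤ x →
      (τ - α * x) / (1 - α) ≤ tauStar (secondRate α x ω R) 1 (1 / 2))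

end ZChannel

/-! The first stage sends a word of a constant-weight code of length `n₁ = ⌈α n⌉` and weight `w = ⌊ω
n₁⌋`. The received support `Y` reveals the number `e = w - #Y` of errors and leaves the list of
codewords containing `Y`. The second stage only has to separate this list against the remaining `t -
e` errors (`twoStageAchievable_of_hasCode`).

First-stage codes of rate `R' < R` come from random choice and expurgation. A Chernoff bound on the
columns of a tuple of `w`-sets gives the exponent `gFun - s ρ` for `l + 1` sets sharing more than `w
- ρ n₁` points, and `tauStar R l ω` marks where this exponent still pays for the factor `M ^ l`.
Since `R' < R`, one code works for all `l ≤ Lup` at once with some `ρ l > tauStar R l ω`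
(`exists_firstStage`).

Let `e ≈ x n₁`. If `x < ρ l`, the list has at most `l` members, and repetitions of a good code of
size `l` separate it. If `x ≥ ρ l` for all `l`, the list, restricted to the complement of `Y`, is a
constant-weight code with differences at least `ρ 1 n₁`. The Elias–Bassalygo bound
(`card_mul_choose_le`) limits it by the exponent in `secondRate`, and a Gilbert–Varshamov code
separates it, since `tauStar · 1 (1/2)` is the Gilbert–Varshamov function in disguise.

Condition (*) gives weak inequalities only. The gap `ρ l > tauStar R l ω` and the strict decrease of
the residual error fraction in `x` make them strict, which absorbs all lower-order terms. Uniformity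
in `e` follows by compactness (`eventually_forall_solvable`), and finally `R'` tends to `R`. -/

open Finset
open scoped symmDiff

namespace ZChannel

/-! ### Johnson and Elias–Bassalygo bounds for constant-weight codes. -/

/-- Johnson's bound for a family of `m`-sets with small pairwise intersections. -/
theorem card_le_of_card_inter_le {α : Type*} [Fintype α] [DecidableEq α] (F : Finset (Finset α))
    (m d : ℕ) (hF : ∀ A ∈ F, #A = m)
    (hd : ∀ A ∈ F, ∀ B ∈ F, A ≠ B → #(A ∩ B) + d ≤ m)
    (hm : (m : ℤ) * (Fintype.card α - m) < d * Fintype.card α) :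
    #F ≤ d * Fintype.card α := by
  rcases F.eq_empty_or_nonempty with rfl | hne
  · simp
  set N := Fintype.card α
  let f : Finset α → α → ℤ := fun A i => if i ∈ A then 1 else 0
  have h1 : ∑ i, ∑ A ∈ F, f A i = #F * m := by
    rw [sum_comm]
    simp only [f, sum_ite_mem, univ_inter, sum_const, nsmul_eq_mul, mul_one]
    rw [sum_congr rfl fun A hA => by rw [hF A hA]]
    simp
  have h2 : ∑ i, (∑ A ∈ F, f A i) ^ 2 = ∑ A ∈ F, ∑ B ∈ F, (#(A ∩ B) : ℤ) := by
    simp_rw [sq, sum_mul_sum]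
    rw [sum_comm]
    refine sum_congr rfl fun A _ => ?_
    rw [sum_comm]
    refine sum_congr rfl fun B _ => ?_
    have : ∀ i, f A i * f B i = if i ∈ A ∩ B then 1 else 0 := by
      intro i; simp only [f, mem_inter]; split_ifs <;> simp_all
    simp only [this, sum_ite_mem, univ_inter, sum_const, nsmul_eq_mul, mul_one]
  have h3 : ∀ A ∈ F, ∑ B ∈ F, (#(A ∩ B) : ℤ) ≤ d + #F * ((m : ℤ) - d) := by
    intro A hA
    calc ∑ B ∈ F, (#(A ∩ B) : ℤ) ≤ ∑ B ∈ F, (((m : ℤ) - d) + if A = B then (d : ℤ) else 0) := by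
          refine sum_le_sum fun B hB => ?_
          split_ifs with h
          · subst h; simp [hF A hA]
          · have := hd A hA B hB h; omega
      _ = d + #F * ((m : ℤ) - d) := by
          rw [sum_add_distrib, sum_ite_eq]; simp [hA]; ring
  -- Cauchy–Schwarz for the point degrees: they sum to `#F * m`, and their squares count pairwise
  -- intersections.
  have h4 := sq_sum_le_card_mul_sum_sq (s := (univ : Finset α)) (f := fun i => ∑ A ∈ F, f A i)
  rw [h1, h2, card_univ] at h4
  have h5 : ∑ A ∈ F, ∑ B ∈ F, (#(A ∩ B) : ℤ) ≤ #F * (d + #F * ((m : ℤ) - d)) := by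
    calc _ ≤ ∑ A ∈ F, ((d : ℤ) + #F * ((m : ℤ) - d)) := sum_le_sum h3
      _ = _ := by simp
  have hJ : (0 : ℤ) < #F := by exact_mod_cast hne.card_pos
  have h6 : (#F : ℤ) * (#F * m * m) ≤ #F * (N * (d + #F * ((m : ℤ) - d))) := by
    calc (#F : ℤ) * (#F * m * m) = (#F * m) ^ 2 := by ring
      _ ≤ _ := h4
      _ ≤ (N : ℤ) * (#F * (d + #F * ((m : ℤ) - d))) := by gcongr
      _ = _ := by ring
  have h7 := le_of_mul_le_mul_left h6 hJ
  -- By `hm` and integrality the coefficient `m² - N (m - d)` of `#F` is at least 1.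
  have h8 : (#F : ℤ) ≤ d * N := by nlinarith
  exact_mod_cast h8

/-- A discrete intermediate value argument: as the initial segment grows from empty to full, the
size goes from `m` to `N - m` and rises by at most one per step. -/
theorem exists_card_symmDiff_eq {N m k : ℕ} (S : Finset (Fin N)) (hS : #S = m) (hmk : m ≤ k)
    (hk : k + m ≤ N) : ∃ v ≤ N, #((univ.filter fun i : Fin N => i.val < v) ∆ S) = k := by
  set q : ℕ → ℕ := fun v => #((univ.filter fun i : Fin N => i.val < v) ∆ S)
  have q0 : q 0 = m := by simp [q, ← Finset.bot_eq_empty, hS]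
  have qN : q N = N - m := by
    have : (univ.filter fun i : Fin N => i.val < N) = univ := by ext; simp
    simp only [q, this]
    rw [← hS, ← Finset.top_eq_univ, top_symmDiff, hnot_eq_compl, Finset.card_compl, Fintype.card_fin]
  have qs : ∀ v, q (v + 1) ≤ q v + 1 := by
    intro v
    calc q (v + 1) ≤ #(((univ.filter fun i : Fin N => i.val < v) ∆ S) ∪
          univ.filter fun i : Fin N => i.val = v) := by
          refine card_le_card fun i => ?_
          simp only [mem_symmDiff, mem_union, mem_filter, mem_univ, true_and]
          by_cases h : i.val = v
          · simp [h]
          · have : i.val < v + 1 ↔ i.val < v := by omega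
            rw [this]; tauto
      _ ≤ _ := (card_union_le _ _).trans (by
          gcongr
          exact card_le_one.2 fun a ha b hb => by
            simp only [mem_filter, mem_univ, true_and] at ha hb; exact Fin.ext (ha.trans hb.symm))
  have hex : ∃ v, k ≤ q v := ⟨N, by omega⟩
  classical
  refine ⟨Nat.find hex, Nat.find_min' hex (by omega), ?_⟩
  have hs := Nat.find_spec hex
  refine le_antisymm ?_ hs
  change q (Nat.find hex) ≤ k
  rcases h : Nat.find hex with _ | v
  · omega
  · have := Nat.find_min hex (m := v) (by omega)
    have := qs v
    omega

theorem card_symmDiff_eq {α : Type*} [DecidableEq α] (A B : Finset α) :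
    #(A ∆ B) + 2 * #(A ∩ B) = #A + #B := by
  have h1 := card_sdiff_add_card_inter A B
  have h2 := card_sdiff_add_card_inter B A
  have h3 : #(A ∆ B) = #(A \ B) + #(B \ A) := by
    rw [symmDiff_def, sup_eq_union, card_union_of_disjoint disjoint_sdiff_sdiff]
  rw [inter_comm B A] at h2
  omega

/-- A permutation-averaging form of the Elias–Bassalygo bound for constant weight codes. -/
theorem card_mul_choose_le {N m k d : ℕ} (F : Finset (Finset (Fin N))) (hF : ∀ A ∈ F, #A = k)
    (hd : ∀ A ∈ F, ∀ B ∈ F, A ≠ B → d ≤ #(A \ B)) (hmk : m ≤ k) (hk : k + m ≤ N)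
    (hm : (m : ℤ) * (N - m) < d * N) :
    #F * N.choose m ≤ (N + 1) * (d * N) * N.choose k := by
  classical
  let I : ℕ → Finset (Fin N) := fun v => univ.filter fun i : Fin N => i.val < v
  let P : Equiv.Perm (Fin N) → Finset (Fin N) → Prop := fun π Y => Y.map π.toEmbedding ∈ F
  let T : Finset (Fin N) → ℕ := fun Y => #{π | P π Y}
  -- A random permutation carries a fixed `k`-set to a uniform one, so it hits `F` with probability
  -- `#F / N.choose k`.
  have hT : ∀ Y ∈ powersetCard k (univ : Finset (Fin N)), N.choose k * T Y = N.factorial * #F := by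
    intro Y hY
    rw [mem_powersetCard] at hY
    have hc : ∀ Y' ∈ powersetCard k (univ : Finset (Fin N)), T Y' = T Y := by
      intro Y' hY'
      rw [mem_powersetCard] at hY'
      obtain ⟨σ, hσ⟩ : ∃ σ : Equiv.Perm (Fin N), Y.map σ.toEmbedding = Y' := by
        have e : {i // i ∈ Y} ≃ {i // i ∈ Y'} :=
          Fintype.equivOfCardEq (by simp [hY.2, hY'.2])
        refine ⟨e.extendSubtype, eq_of_subset_of_card_le ?_ (by simp [hY.2, hY'.2])⟩
        intro j hj
        obtain ⟨i, hi, rfl⟩ := mem_map.1 hj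
        exact e.extendSubtype_mem i hi
      refine card_bij' (fun π _ => π * σ) (fun π _ => π * σ⁻¹) ?_ ?_ ?_ ?_
      · intro π hπ
        simp only [mem_filter, mem_univ, true_and, P] at hπ ⊢
        rw [← hσ, map_map] at hπ
        exact hπ
      · intro π hπ
        simp only [mem_filter, mem_univ, true_and, P] at hπ ⊢
        rw [← hσ, map_map]
        convert hπ using 2
        ext i; simp
      · intro π _; simp
      · intro π _; simp
    calc N.choose k * T Y = ∑ Y' ∈ powersetCard k (univ : Finset (Fin N)), T Y' := by
          rw [sum_congr rfl hc]; simp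
      _ = ∑ π : Equiv.Perm (Fin N), #{Y' ∈ powersetCard k (univ : Finset (Fin N)) | P π Y'} := by
          exact sum_card_bipartiteAbove_eq_sum_card_bipartiteBelow (fun Y' π => P π Y')
      _ = ∑ π : Equiv.Perm (Fin N), #F := by
          refine sum_congr rfl fun π _ => ?_
          refine card_bij' (fun Y' _ => Y'.map π.toEmbedding)
            (fun A _ => A.map π.symm.toEmbedding) ?_ ?_ ?_ ?_
          · intro Y' hY'; exact (mem_filter.1 hY').2
          · intro A hA
            simp only [mem_filter, mem_powersetCard, P, map_map]
            refine ⟨⟨subset_univ _, by simp [hF A hA]⟩, ?_⟩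
            convert hA; ext i; simp
          · intro Y' _; ext i; simp
          · intro A _; ext i; simp
      _ = N.factorial * #F := by simp [Fintype.card_perm]
  -- Symmetric difference with a fixed `I v` preserves distances, so for fixed `π` and `v` the
  -- admissible `S` form a code of weight `m` to which Johnson's bound applies.
  have hupper : ∀ π : Equiv.Perm (Fin N),
      #{S ∈ powersetCard m (univ : Finset (Fin N)) | ∃ v ≤ N, P π (I v ∆ S)} ≤
        (N + 1) * (d * N) := by
    intro π
    calc _ ≤ #((range (N + 1)).biUnion fun v =>
            {S ∈ powersetCard m (univ : Finset (Fin N)) | P π (I v ∆ S)}) := by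
          refine card_le_card fun S hS => ?_
          simp only [mem_filter, mem_biUnion, mem_range] at hS ⊢
          obtain ⟨h1, v, hv, h2⟩ := hS
          exact ⟨v, by omega, h1, h2⟩
      _ ≤ #(range (N + 1)) * (d * N) := by
          refine card_biUnion_le_card_mul _ _ _ fun v _ => ?_
          have := card_le_of_card_inter_le
            {S ∈ powersetCard m (univ : Finset (Fin N)) | P π (I v ∆ S)} m d
            (fun A hA => (mem_powersetCard.1 (mem_filter.1 hA).1).2) ?_ (by simpa using hm)
          · simpa using this
          intro A hA B hB hAB
          simp only [mem_filter, mem_powersetCard, P] at hA hB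
          have hne : (I v ∆ A).map π.toEmbedding ≠ (I v ∆ B).map π.toEmbedding := by
            intro h
            exact hAB (symmDiff_right_injective (I v) (map_injective _ h))
          have h1 := hd _ hA.2 _ hB.2 hne
          have h2 := hd _ hB.2 _ hA.2 hne.symm
          have h3 : #((I v ∆ A) ∆ (I v ∆ B)) = #(A ∆ B) := by
            rw [symmDiff_symmDiff_symmDiff_comm, symmDiff_self, bot_symmDiff]
          have h4 : #((I v ∆ A) ∆ (I v ∆ B)) = #((I v ∆ A) \ (I v ∆ B)) +
              #((I v ∆ B) \ (I v ∆ A)) := by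
            rw [symmDiff_def (I v ∆ A), sup_eq_union, card_union_of_disjoint disjoint_sdiff_sdiff]
          have h5 : ∀ X Y : Finset (Fin N), #(X.map π.toEmbedding \ Y.map π.toEmbedding)
              = #(X \ Y) := by
            intro X Y
            rw [← card_map π.toEmbedding (s := X \ Y)]
            congr 1
            ext i; simp [Finset.mem_sdiff]
          rw [h5] at h1 h2
          have h6 := card_symmDiff_eq A B
          omega
      _ = _ := by simp
  have hlow : ∀ S ∈ powersetCard m (univ : Finset (Fin N)),
      N.factorial * #F ≤ N.choose k * #{π | ∃ v ≤ N, P π (I v ∆ S)} := by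
    intro S hS
    obtain ⟨v, hv, hvk⟩ := exists_card_symmDiff_eq S (mem_powersetCard.1 hS).2 hmk hk
    rw [← hT (I v ∆ S) (mem_powersetCard.2 ⟨subset_univ _, hvk⟩)]
    gcongr
    refine card_le_card fun π hπ => ?_
    simp only [mem_filter, mem_univ, true_and] at hπ ⊢
    exact ⟨v, hv, hπ⟩
  have key : N.factorial * (#F * N.choose m) ≤
      N.factorial * ((N + 1) * (d * N) * N.choose k) := by
    calc N.factorial * (#F * N.choose m)
        = ∑ S ∈ powersetCard m (univ : Finset (Fin N)), N.factorial * #F := by simp; ring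
      _ ≤ ∑ S ∈ powersetCard m (univ : Finset (Fin N)),
          N.choose k * #{π | ∃ v ≤ N, P π (I v ∆ S)} := sum_le_sum hlow
      _ = N.choose k * ∑ π : Equiv.Perm (Fin N),
          #{S ∈ powersetCard m (univ : Finset (Fin N)) | ∃ v ≤ N, P π (I v ∆ S)} := by
          rw [← mul_sum]
          congr 1
          exact sum_card_bipartiteAbove_eq_sum_card_bipartiteBelow
            (fun S π => ∃ v ≤ N, P π (I v ∆ S))
      _ ≤ N.choose k * ∑ π : Equiv.Perm (Fin N), (N + 1) * (d * N) := by
          gcongr with π; exact hupper π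
      _ = _ := by simp [Fintype.card_perm]; ring
  exact le_of_mul_le_mul_left key N.factorial_pos

/-- The averaging argument needs `m ≤ k ≤ N - m`. For other `k` one has `k (N - k) ≤ m (N - m)`, so
Johnson's bound applies directly at weight `k`. -/
theorem card_constantWeight_le {N m k d : ℕ} (F : Finset (Finset (Fin N))) (hF : ∀ A ∈ F, #A = k)
    (hd : ∀ A ∈ F, ∀ B ∈ F, A ≠ B → d ≤ #(A \ B)) (hmN : 2 * m ≤ N)
    (hm : (m : ℤ) * (N - m) < d * N) :
    #F * N.choose m ≤ (N + 1) ^ 3 * max (N.choose k) (N.choose m) := by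
  rcases le_or_gt #F 1 with h1 | h1
  · calc #F * N.choose m ≤ 1 * N.choose m := by gcongr
      _ ≤ (N + 1) ^ 3 * max (N.choose k) (N.choose m) := by
        gcongr
        · exact Nat.one_le_pow _ _ (by omega)
        · exact le_max_right _ _
  have hdN : d ≤ N := by
    obtain ⟨A, hA, B, hB, hAB⟩ := one_lt_card.1 h1
    exact (hd A hA B hB hAB).trans ((card_le_univ _).trans (by simp))
  have hdN2 : d * N ≤ (N + 1) ^ 2 := by nlinarith
  by_cases hk : m ≤ k ∧ k + m ≤ N
  · calc _ ≤ (N + 1) * (d * N) * N.choose k := card_mul_choose_le F hF hd hk.1 hk.2 hm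
      _ ≤ (N + 1) * (N + 1) ^ 2 * max (N.choose k) (N.choose m) := by
        gcongr; exact le_max_left _ _
      _ = _ := by ring
  · have hkN : k ≤ N := by
      obtain ⟨A, hA⟩ := card_pos.1 (by omega : 0 < #F)
      rw [← hF A hA]; exact (card_le_univ _).trans (by simp)
    have hkm : (k : ℤ) * (N - k) ≤ m * (N - m) := by
      rcases lt_or_ge k m with h | h
      · nlinarith
      · have : N < k + m := by omega
        nlinarith
    have := card_le_of_card_inter_le F k d hF (fun A hA B hB hAB => by
      have h1 := hd A hA B hB hAB
      have h2 := card_sdiff_add_card_inter A B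
      have h3 := hF A hA
      omega) (by simpa using hkm.trans_lt hm)
    rw [Fintype.card_fin] at this
    calc #F * N.choose m ≤ (N + 1) ^ 3 * N.choose m := by
          gcongr
          exact this.trans (hdN2.trans (Nat.pow_le_pow_right (by omega) (by omega)))
      _ ≤ _ := by gcongr; exact le_max_right _ _

/-! ### Entropy estimates for binomial coefficients and Hamming balls. -/

/-- The binomial distribution with parameter `k / N` has a mode at `k`, because consecutive terms
have ratio `(N - j) k / ((j + 1) (N - k))`. The term at `k` is therefore at least `1 / (N + 1)` of
the total. -/
theorem choose_mul_pow_le_mode {N k j : ℕ} (hk : k ≤ N) (hj : j ≤ N) :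
    N.choose j * (k ^ j * (N - k) ^ (N - j)) ≤ N.choose k * (k ^ k * (N - k) ^ (N - k)) := by
  set U : ℕ → ℕ := fun j => N.choose j * (k ^ j * (N - k) ^ (N - j)) with hU
  have step : ∀ j < N, U (j + 1) * ((j + 1) * (N - k)) = U j * ((N - j) * k) := by
    intro j hj
    have h1 := Nat.choose_succ_right_eq N j
    have h2 : (N - k) ^ (N - j) = (N - k) ^ (N - (j + 1)) * (N - k) := by
      rw [← pow_succ]; congr 1; omega
    calc U (j + 1) * ((j + 1) * (N - k))
        = (N.choose (j + 1) * (j + 1)) * (k ^ (j + 1) * ((N - k) ^ (N - (j + 1)) * (N - k))) := by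
          simp only [hU]; ring
      _ = U j * ((N - j) * k) := by rw [h1, ← h2]; simp only [hU]; ring
  have up : ∀ j < k, U j ≤ U (j + 1) := by
    intro j hj
    have hkj : k - j ≠ 0 := by omega
    rcases Nat.eq_or_lt_of_le hk with rfl | h
    · simp [hU, hkj]
    · have h0 : 0 < (j + 1) * (N - k) := Nat.mul_pos (by omega) (by omega)
      refine le_of_mul_le_mul_right ?_ h0
      rw [step j (by omega)]
      exact Nat.mul_le_mul_left _ ((Nat.mul_le_mul (by omega : j + 1 ≤ k)
        (by omega : N - k ≤ N - j)).trans_eq (mul_comm _ _))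
  have down : ∀ j, k ≤ j → j < N → U (j + 1) ≤ U j := by
    intro j hkj hj
    have h0 : 0 < (j + 1) * (N - k) := Nat.mul_pos (by omega) (by omega)
    refine le_of_mul_le_mul_right ?_ h0
    rw [step j (by omega)]
    exact Nat.mul_le_mul_left _ ((Nat.mul_le_mul (by omega : N - j ≤ N - k)
      (by omega : k ≤ j + 1)).trans_eq (mul_comm _ _))
  change U j ≤ U k
  rcases le_total j k with h | h
  · exact Nat.decreasingInduction (motive := fun i _ => U i ≤ U k)
      (fun i hi ih => (up i hi).trans ih) le_rfl h
  · have : ∀ i, k ≤ i → i ≤ N → U i ≤ U k := by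
      intro i hi
      induction i, hi using Nat.le_induction with
      | base => intro _; exact le_rfl
      | succ i hi ih => intro h'; exact (down i hi (by omega)).trans (ih (by omega))
    exact this j h hj

theorem sum_choose_mul_pow {N k : ℕ} (hk : k ≤ N) :
    ∑ j ∈ range (N + 1), N.choose j * (k ^ j * (N - k) ^ (N - j)) = N ^ N := by
  have h := add_pow k (N - k) N
  rw [Nat.add_sub_cancel' hk] at h
  rw [h]
  exact sum_congr rfl fun j _ => by simp; ring

theorem choose_mul_pow_le {N k : ℕ} (hk : k ≤ N) :
    N.choose k * (k ^ k * (N - k) ^ (N - k)) ≤ N ^ N := by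
  rw [← sum_choose_mul_pow hk]
  exact single_le_sum (f := fun j => N.choose j * (k ^ j * (N - k) ^ (N - j)))
    (fun _ _ => Nat.zero_le _) (mem_range.2 (by omega))

theorem pow_le_choose_mul_pow {N k : ℕ} (hk : k ≤ N) :
    N ^ N ≤ (N + 1) * (N.choose k * (k ^ k * (N - k) ^ (N - k))) := by
  rw [← sum_choose_mul_pow hk]
  calc _ ≤ ∑ j ∈ range (N + 1), N.choose k * (k ^ k * (N - k) ^ (N - k)) :=
        sum_le_sum fun j hj => choose_mul_pow_le_mode hk (by simpa [Nat.lt_succ_iff] using hj)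
    _ = _ := by simp

theorem exp_mul_binEntropy {N k : ℕ} (hk : k ≤ N) :
    Real.exp (N * Real.binEntropy (k / N)) * ((k : ℝ) ^ k * ((N - k : ℕ) : ℝ) ^ (N - k)) =
      (N : ℝ) ^ N := by
  rcases Nat.eq_zero_or_pos N with rfl | hN
  · simp at hk; subst hk; simp
  have hN' : (0 : ℝ) < N := by exact_mod_cast hN
  have aux : ∀ a : ℕ, Real.exp (-(a * Real.log (a / N))) * (a : ℝ) ^ a = (N : ℝ) ^ a := by
    intro a
    rcases Nat.eq_zero_or_pos a with rfl | ha
    · simp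
    have ha' : (0 : ℝ) < a := by exact_mod_cast ha
    rw [Real.exp_neg, Real.exp_nat_mul, Real.exp_log (by positivity), div_pow]
    field_simp
  have h1 : (N : ℝ) * Real.binEntropy (k / N) =
      -(k * Real.log (k / N)) + -((N - k : ℕ) * Real.log ((N - k : ℕ) / N)) := by
    rw [Real.binEntropy, Real.log_inv, Real.log_inv, Nat.cast_sub hk, sub_div, div_self hN'.ne']
    field_simp
  rw [h1, Real.exp_add, mul_mul_mul_comm, aux, aux, ← pow_add, Nat.add_sub_cancel' hk]

theorem pow_mul_pow_pos (N k : ℕ) :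
    0 < (k : ℝ) ^ k * ((N - k : ℕ) : ℝ) ^ (N - k) := by
  have : ∀ a : ℕ, 0 < (a : ℝ) ^ a := by
    intro a
    rcases Nat.eq_zero_or_pos a with rfl | ha
    · simp
    · positivity
  exact mul_pos (this _) (this _)

theorem choose_le_exp_binEntropy {N k : ℕ} (hk : k ≤ N) :
    (N.choose k : ℝ) ≤ Real.exp (N * Real.binEntropy (k / N)) := by
  have h := choose_mul_pow_le hk
  refine le_of_mul_le_mul_right ?_ (pow_mul_pow_pos N k)
  rw [exp_mul_binEntropy hk]
  exact_mod_cast h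

theorem exp_binEntropy_le_choose {N k : ℕ} (hk : k ≤ N) :
    Real.exp (N * Real.binEntropy (k / N)) ≤ (N + 1) * N.choose k := by
  have h := pow_le_choose_mul_pow hk
  refine le_of_mul_le_mul_right ?_ (pow_mul_pow_pos N k)
  rw [exp_mul_binEntropy hk]
  rw [mul_assoc]
  exact_mod_cast h

/-- The number of sets of size at most `D`. -/
def ballCard (n D : ℕ) : ℕ := #{S : Finset (Fin n) | #S ≤ D}

theorem ballCard_pos (n D : ℕ) : 0 < ballCard n D :=
  card_pos.2 ⟨∅, by simp⟩

theorem ballCard_mul_pow_le (n D : ℕ) {u : ℝ} (hu0 : 0 < u) (hu1 : u ≤ 1) :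
    (ballCard n D : ℝ) * u ^ D ≤ (1 + u) ^ n := by
  have h := Fin.sum_pow_mul_eq_add_pow (n := n) u 1
  rw [add_comm, ← h, ballCard, ← nsmul_eq_mul, ← sum_const]
  calc _ ≤ ∑ S ∈ {S : Finset (Fin n) | #S ≤ D}, u ^ #S * 1 ^ (n - #S) := by
        refine sum_le_sum fun S hS => ?_
        rw [one_pow, mul_one]
        exact pow_le_pow_of_le_one hu0.le hu1 (by simpa using hS)
    _ ≤ _ := sum_le_sum_of_subset_of_nonneg (subset_univ _) fun _ _ _ => by positivity

/-- Chernoff bound with the tilt `u = p / (1 - p)`, which is at most 1 because `p ≤ 1 / 2`. -/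
theorem ballCard_le_exp (n D : ℕ) {p : ℝ} (hp0 : 0 < p) (hp1 : p ≤ 1 / 2) (hD : (D : ℝ) ≤ p * n) :
    (ballCard n D : ℝ) ≤ Real.exp (n * Real.binEntropy p) := by
  have hq : 0 < 1 - p := by linarith
  have hu0 : 0 < p / (1 - p) := by positivity
  have hu1 : p / (1 - p) ≤ 1 := by rw [div_le_one hq]; linarith
  have h := ballCard_mul_pow_le n D hu0 hu1
  have h1 : 1 + p / (1 - p) = (1 - p)⁻¹ := by field_simp; ring
  rw [h1] at h
  have e1 : (p / (1 - p)) ^ D = Real.exp (D * (Real.log p - Real.log (1 - p))) := by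
    rw [Real.exp_nat_mul, Real.exp_sub, Real.exp_log hp0, Real.exp_log hq]
  have e2 : ((1 - p)⁻¹) ^ n = Real.exp (n * -Real.log (1 - p)) := by
    rw [Real.exp_nat_mul, Real.exp_neg, Real.exp_log hq]
  rw [e1, e2] at h
  have hl : Real.log p - Real.log (1 - p) ≤ 0 := by
    have := Real.log_le_log hp0 (by linarith : p ≤ 1 - p)
    linarith
  rw [← le_div_iff₀ (Real.exp_pos _), ← Real.exp_sub] at h
  refine h.trans (Real.exp_le_exp.2 ?_)
  rw [Real.binEntropy, Real.log_inv, Real.log_inv]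
  nlinarith

/-! ### Codes for the second stage: Gilbert–Varshamov and repetition. -/

/-- The greedy (Gilbert–Varshamov) argument. -/
theorem exists_separated_subset {α : Type*} [DecidableEq α] (X : Finset α) (r : α → α → Prop)
    [DecidableRel r] (hr : ∀ a, r a a) (hs : ∀ a b, r a b → r b a) (V : ℕ)
    (hV : ∀ a ∈ X, #{b ∈ X | r a b} ≤ V) :
    ∃ C ⊆ X, #X ≤ #C * V ∧ ∀ a ∈ C, ∀ b ∈ C, a ≠ b → ¬ r a b := by
  classical
  obtain ⟨C, hC, hmax⟩ := exists_max_image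
    {C ∈ X.powerset | ∀ a ∈ C, ∀ b ∈ C, a ≠ b → ¬ r a b} card ⟨∅, by simp⟩
  simp only [mem_filter, mem_powerset] at hC hmax
  refine ⟨C, hC.1, ?_, hC.2⟩
  calc #X ≤ #(C.biUnion fun a => {b ∈ X | r a b}) := by
        refine card_le_card fun b hb => ?_
        by_contra hcon
        simp only [mem_biUnion, mem_filter, not_exists, not_and] at hcon
        have hbC : b ∉ C := fun h => hcon b h hb (hr b)
        have := hmax (insert b C) ⟨insert_subset hb hC.1, ?_⟩
        · rw [card_insert_of_notMem hbC] at this; omega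
        · intro x hx y hy hxy hrxy
          rcases mem_insert.1 hx with hx' | hx' <;> rcases mem_insert.1 hy with hy' | hy'
          · exact hxy (hx'.trans hy'.symm)
          · exact hcon y hy' hb (hs _ _ (hx' ▸ hrxy))
          · exact hcon x hx' hb (hy' ▸ hrxy)
          · exact hC.2 x hx' y hy' hxy hrxy
    _ ≤ #C * V := card_biUnion_le_card_mul _ _ _ fun a ha => hV a (hC.1 ha)

/-- There are at least `K` words of length `n` such that `r` asymmetric errors can be corrected. -/
def HasCode (n K r : ℕ) : Prop :=
  ∃ C : Finset (Finset (Fin n)), K ≤ #C ∧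
    ∀ A ∈ C, ∀ B ∈ C, A ≠ B → r < max #(A \ B) #(B \ A)

theorem hasCode_of_le_one {n K : ℕ} (r : ℕ) (hK : K ≤ 1) : HasCode n K r :=
  ⟨{∅}, by simpa using hK, by simp⟩

/-- More than `2 r` differing positions leave more than `r` in one of the two directions. -/
theorem hasCode_of_mul_ballCard_le {n K r : ℕ} (h : K * ballCard n (2 * r) ≤ 2 ^ n) :
    HasCode n K r := by
  obtain ⟨C, -, h1, h2⟩ := exists_separated_subset (univ : Finset (Finset (Fin n)))
    (fun A B => #(A ∆ B) ≤ 2 * r) (by simp) (fun A B h => by rwa [symmDiff_comm])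
    (ballCard n (2 * r)) (fun A _ => by
      refine (card_le_card_of_injOn (fun B => A ∆ B) ?_ ?_)
      · intro B hB; simpa using hB
      · intro B _ B' _ h; exact symmDiff_right_injective A h)
  refine ⟨C, ?_, fun A hA B hB hAB => ?_⟩
  · rw [card_univ, Fintype.card_finset, Fintype.card_fin] at h1
    exact le_of_mul_le_mul_right (h.trans h1) (ballCard_pos _ _)
  · have := h2 A hA B hB hAB
    have h4 : #(A ∆ B) = #(A \ B) + #(B \ A) := by
      rw [symmDiff_def, sup_eq_union, card_union_of_disjoint disjoint_sdiff_sdiff]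
    omega

theorem hasCode_of_le_exp {n K r : ℕ} {p : ℝ} (hp0 : 0 < p) (hp1 : p ≤ 1 / 2)
    (hr : 2 * (r : ℝ) ≤ p * n)
    (hK : (K : ℝ) ≤ Real.exp (n * (Real.log 2 - Real.binEntropy p))) : HasCode n K r := by
  refine hasCode_of_mul_ballCard_le ?_
  have h1 := ballCard_le_exp n (2 * r) hp0 hp1 (by push_cast; exact hr)
  have h2 : (K : ℝ) * ballCard n (2 * r) ≤ 2 ^ n := by
    calc (K : ℝ) * ballCard n (2 * r) ≤ Real.exp (n * (Real.log 2 - Real.binEntropy p)) *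
          Real.exp (n * Real.binEntropy p) := by gcongr
      _ = 2 ^ n := by
        rw [← Real.exp_add, ← mul_add, sub_add_cancel, Real.exp_nat_mul,
          Real.exp_log (by norm_num)]
  exact_mod_cast h2

/-- Repeating a code `n / n₀` times multiplies each one-sided difference by that factor; leftover
positions stay zero. -/
theorem hasCode_of_repeat {n₀ L d : ℕ} (C : Finset (Finset (Fin n₀))) (hL : L ≤ #C)
    (hC : ∀ A ∈ C, ∀ B ∈ C, A ≠ B → d ≤ max #(A \ B) #(B \ A)) {n r : ℕ}
    (hr : r < n / n₀ * d) : HasCode n L r := by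
  let f : Finset (Fin n₀) → Finset (Fin n) := fun A =>
    univ.filter fun i : Fin n => i.val < n / n₀ * n₀ ∧ ∃ a ∈ A, i.val % n₀ = a.val
  have key : ∀ A B, n / n₀ * #(A \ B) ≤ #(f A \ f B) := by
    intro A B
    calc n / n₀ * #(A \ B) = #((univ : Finset (Fin (n / n₀))) ×ˢ (A \ B)) := by
          simp [card_product]
      _ ≤ _ := by
          have hlt : ∀ q : Fin (n / n₀), ∀ a : Fin n₀, q.val * n₀ + a.val < n / n₀ * n₀ := by
            intro q a
            calc q.val * n₀ + a.val < q.val * n₀ + n₀ := by have := a.isLt; omega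
              _ = (q.val + 1) * n₀ := by ring
              _ ≤ n / n₀ * n₀ := by gcongr; exact q.isLt
          have hmod : ∀ q : Fin (n / n₀), ∀ a : Fin n₀, (q.val * n₀ + a.val) % n₀ = a.val := by
            intro q a
            rw [mul_comm, Nat.mul_add_mod, Nat.mod_eq_of_lt a.isLt]
          refine card_le_card_of_injOn (fun x : Fin (n / n₀) × Fin n₀ =>
            (⟨x.1.val * n₀ + x.2.val, (hlt x.1 x.2).trans_le (Nat.div_mul_le_self n n₀)⟩ : Fin n))
            ?_ ?_
          · rintro ⟨q, a⟩ h
            simp only [coe_product, Set.mem_prod, mem_coe, Finset.mem_sdiff] at h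
            simp only [f, mem_coe, Finset.mem_sdiff, mem_filter, mem_univ, true_and, hmod, not_and,
              not_exists]
            refine ⟨⟨hlt q a, a, h.2.1, rfl⟩, fun _ b hb hab => h.2.2 ?_⟩
            rwa [Fin.ext hab]
          · rintro ⟨q, a⟩ _ ⟨q', a'⟩ _ h
            simp only [Fin.mk.injEq] at h
            have ha : a = a' := Fin.ext (by rw [← hmod q a, ← hmod q' a', h])
            subst ha
            have h' : q.val * n₀ = q'.val * n₀ := by omega
            have hq : q.val = q'.val :=
              Nat.eq_of_mul_eq_mul_right (lt_of_le_of_lt (Nat.zero_le _) a.isLt) h'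
            rw [Fin.ext hq]
  have key2 : ∀ A ∈ C, ∀ B ∈ C, A ≠ B → r < max #(f A \ f B) #(f B \ f A) := by
    intro A hA B hB hAB
    have h1 := key A B
    have h2 := key B A
    rcases le_max_iff.1 (hC A hA B hB hAB) with h | h
    · exact lt_max_of_lt_left (hr.trans_le ((Nat.mul_le_mul_left _ h).trans h1))
    · exact lt_max_of_lt_right (hr.trans_le ((Nat.mul_le_mul_left _ h).trans h2))
  have hinj : Set.InjOn f C := by
    intro A hA B hB h
    by_contra hAB
    have := key2 A hA B hB hAB
    simp [h] at this
  refine ⟨C.image f, by rwa [card_image_of_injOn hinj], ?_⟩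
  intro A' hA' B' hB' hne
  obtain ⟨A, hA, rfl⟩ := mem_image.1 hA'
  obtain ⟨B, hB, rfl⟩ := mem_image.1 hB'
  exact key2 A hA B hB fun h => hne (h ▸ rfl)

/-! ### Counting tuples of sets with a large common intersection. -/

/-- The number of positions contained in all members of a tuple of sets. -/
def overlap {n l : ℕ} (c : Fin (l + 1) → Finset (Fin n)) : ℕ := #{i | ∀ j, i ∈ c j}

open Classical in
/-- Tuples of `w`-sets with more than `w - θ` common elements. -/
noncomputable def badTuples (n w l : ℕ) (θ : ℝ) : Finset (Fin (l + 1) → Finset (Fin n)) :=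
  {c ∈ Fintype.piFinset fun _ => powersetCard w univ | (w : ℝ) < overlap c + θ}

/-- The weight of a column with `i` ones in the Chernoff bound. -/
noncomputable def columnWeight (s p : ℝ) (l i : ℕ) : ℝ :=
  p ^ i * (1 - p) ^ (l + 1 - i) *
    Real.exp (-s * ((i : ℝ) / (l + 1) - if i = l + 1 then 1 else 0))

theorem sum_columnWeight (s p : ℝ) (l : ℕ) :
    ∑ K : Finset (Fin (l + 1)), columnWeight s p l #K = partitionSum s l p := by
  have h := sum_powerset_apply_card (x := (univ : Finset (Fin (l + 1)))) (columnWeight s p l)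
  rw [powerset_univ, card_univ, Fintype.card_fin] at h
  rw [h, sum_range_succ, sum_range_succ', partitionSum]
  have hl : ((l : ℝ) + 1) ≠ 0 := by positivity
  have h0 : Icc 1 l = Ico 1 (l + 1) := by ext; simp
  rw [h0, sum_Ico_eq_sum_range, Nat.add_sub_cancel]
  have h1 : columnWeight s p l (l + 1) = p ^ (l + 1) := by
    simp [columnWeight, div_self hl]
  have h2 : columnWeight s p l 0 = (1 - p) ^ (l + 1) := by
    simp [columnWeight]
  rw [h1, h2]
  simp only [Nat.choose_self, one_smul, Nat.choose_zero_right]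
  have h3 : ∀ i ∈ range l, (l + 1).choose (i + 1) • columnWeight s p l (i + 1) =
      Real.exp (-(s * ((1 + i : ℕ) : ℝ) / (l + 1))) * ((l + 1).choose (1 + i) : ℝ) *
        p ^ (1 + i) * (1 - p) ^ (l + 1 - (1 + i)) := by
    intro i hi
    have : i + 1 ≠ l + 1 := by have := mem_range.1 hi; omega
    rw [columnWeight, if_neg this, add_comm 1 i, nsmul_eq_mul, sub_zero]
    have e : -s * (((i + 1 : ℕ) : ℝ) / (l + 1)) = -(s * ((i + 1 : ℕ) : ℝ) / (l + 1)) := by ring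
    rw [e]
    ring
  rw [sum_congr rfl h3]
  ring

theorem columnWeight_nonneg {s p : ℝ} (hp0 : 0 ≤ p) (hp1 : p ≤ 1) (l i : ℕ) :
    0 ≤ columnWeight s p l i := by
  have : 0 ≤ 1 - p := by linarith
  unfold columnWeight
  positivity

/-- Transposition of a tuple of sets. -/
def columnEquiv (n l : ℕ) :
    (Fin (l + 1) → Finset (Fin n)) ≃ (Fin n → Finset (Fin (l + 1))) where
  toFun c i := {j | i ∈ c j}
  invFun k j := {i | j ∈ k i}
  left_inv c := by ext; simp
  right_inv k := by ext; simp

/-- Over all columns the terms `i / (l + 1)` add up to `w`, and the full columns count the overlap,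
so the tilt depends on `w - overlap c` alone. -/
theorem prod_columnWeight {n w l : ℕ} (s p : ℝ) (c : Fin (l + 1) → Finset (Fin n))
    (hc : ∀ j, #(c j) = w) :
    ∏ i, columnWeight s p l #(columnEquiv n l c i) =
      (p ^ w * (1 - p) ^ (n - w)) ^ (l + 1) * Real.exp (-s * ((w : ℝ) - overlap c)) := by
  have hsum : ∑ i, #(columnEquiv n l c i) = (l + 1) * w := by
    calc ∑ i, #(columnEquiv n l c i) = ∑ j : Fin (l + 1), #{i : Fin n | i ∈ c j} :=
          sum_card_bipartiteAbove_eq_sum_card_bipartiteBelow (fun (i : Fin n) j => i ∈ c j)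
      _ = ∑ j : Fin (l + 1), w := sum_congr rfl fun j _ => by simp [hc]
      _ = _ := by simp
  have hle : ∀ i, #(columnEquiv n l c i) ≤ l + 1 := fun i =>
    (card_le_univ _).trans (by simp)
  have hsum' : ∑ i, (l + 1 - #(columnEquiv n l c i)) = (l + 1) * (n - w) := by
    have h : ∑ i, (l + 1 - #(columnEquiv n l c i)) + ∑ i, #(columnEquiv n l c i) = n * (l + 1) := by
      rw [← sum_add_distrib, sum_congr rfl fun i _ => Nat.sub_add_cancel (hle i)]
      simp
    rw [hsum] at h
    rw [Nat.mul_sub, mul_comm (l + 1) n]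
    omega
  have hover : ∑ i, (if #(columnEquiv n l c i) = l + 1 then (1 : ℝ) else 0) = overlap c := by
    rw [sum_boole, overlap]
    congr 2
    ext i
    have : l + 1 = Fintype.card (Fin (l + 1)) := by simp
    simp only [mem_filter, mem_univ, true_and]
    rw [show (#(columnEquiv n l c i) = l + 1 ↔ #(columnEquiv n l c i) = Fintype.card (Fin (l + 1)))
      by rw [← this], card_eq_iff_eq_univ, eq_univ_iff_forall]
    simp [columnEquiv]
  simp only [columnWeight]
  rw [prod_mul_distrib, prod_mul_distrib, prod_pow_eq_pow_sum, prod_pow_eq_pow_sum, hsum, hsum',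
    ← Real.exp_sum, ← mul_sum, sum_sub_distrib, hover, ← sum_div, ← Nat.cast_sum, hsum]
  have hl : ((l : ℝ) + 1) ≠ 0 := by positivity
  rw [mul_pow, ← pow_mul, ← pow_mul, mul_comm w, mul_comm (n - w)]
  congr 4
  push_cast
  field_simp

/-- Layer `w` has Bernoulli(`w / n`) mass at least `1 / (n + 1)`, so replacing uniform `w`-sets by
independent points costs only a polynomial factor. -/
theorem one_le_layer_mass {n w : ℕ} (hn : 0 < n) (hw : w ≤ n) :
    1 ≤ ((n : ℝ) + 1) * n.choose w * (((w : ℝ) / n) ^ w * (1 - (w : ℝ) / n) ^ (n - w)) := by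
  have h : ((n : ℝ)) ^ n ≤ (n + 1) * (n.choose w * ((w : ℝ) ^ w * ((n - w : ℕ) : ℝ) ^ (n - w))) := by
    exact_mod_cast pow_le_choose_mul_pow hw
  have hn' : (0 : ℝ) < n := by exact_mod_cast hn
  have e1 : 1 - (w : ℝ) / n = ((n - w : ℕ) : ℝ) / n := by
    rw [Nat.cast_sub hw]; field_simp
  have e2 : (n : ℝ) ^ n = (n : ℝ) ^ w * (n : ℝ) ^ (n - w) := by
    rw [← pow_add, Nat.add_sub_cancel' hw]
  rw [e1, div_pow, div_pow, div_mul_div_comm, ← e2, mul_div_assoc', le_div_iff₀ (by positivity)]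
  linarith

theorem card_badTuples_le {n w : ℕ} (hn : 0 < n) (hw : w ≤ n) (l : ℕ) (θ : ℝ) {s : ℝ}
    (hs : 0 < s) :
    (#(badTuples n w l θ) : ℝ) ≤ ((n + 1 : ℝ) * n.choose w) ^ (l + 1) *
      (partitionSum s l (w / n) ^ n * Real.exp (s * θ)) := by
  have hn' : (0 : ℝ) < n := by exact_mod_cast hn
  set p : ℝ := w / n with hp
  have hp0 : 0 ≤ p := by positivity
  have hp1 : p ≤ 1 := by rw [hp, div_le_one hn']; exact_mod_cast hw
  set q : ℝ := p ^ w * (1 - p) ^ (n - w)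
  have hmass : 1 ≤ (n + 1 : ℝ) * n.choose w * q := one_le_layer_mass hn hw
  have h1 : (#(badTuples n w l θ) : ℝ) * q ^ (l + 1) ≤
      partitionSum s l p ^ n * Real.exp (s * θ) := by
    have hq0 : 0 ≤ q ^ (l + 1) := by
      have : 0 ≤ 1 - p := by linarith
      positivity
    calc (#(badTuples n w l θ) : ℝ) * q ^ (l + 1)
        = ∑ c ∈ badTuples n w l θ, q ^ (l + 1) := by simp
      _ ≤ ∑ c ∈ badTuples n w l θ,
          (∏ i, columnWeight s p l #(columnEquiv n l c i)) * Real.exp (s * θ) := by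
          refine sum_le_sum fun c hc => ?_
          simp only [badTuples, mem_filter, Fintype.mem_piFinset, mem_powersetCard] at hc
          rw [prod_columnWeight s p c fun j => (hc.1 j).2, mul_assoc, ← Real.exp_add]
          refine le_mul_of_one_le_right hq0 (Real.one_le_exp ?_)
          nlinarith
      _ ≤ ∑ c, (∏ i, columnWeight s p l #(columnEquiv n l c i)) * Real.exp (s * θ) := by
          refine sum_le_sum_of_subset_of_nonneg (subset_univ _) fun c _ _ => ?_
          exact mul_nonneg (prod_nonneg fun i _ => columnWeight_nonneg hp0 hp1 _ _)
            (Real.exp_pos _).le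
      _ = _ := by
          rw [← sum_mul, (columnEquiv n l).sum_comp fun k => ∏ i, columnWeight s p l #(k i),
            ← Fintype.sum_pow (fun K => columnWeight s p l #K), sum_columnWeight]
  calc (#(badTuples n w l θ) : ℝ) ≤ #(badTuples n w l θ) * ((n + 1 : ℝ) * n.choose w * q) ^ (l + 1) :=
        le_mul_of_one_le_right (by positivity) (one_le_pow₀ hmass)
    _ = ((n + 1 : ℝ) * n.choose w) ^ (l + 1) * (#(badTuples n w l θ) * q ^ (l + 1)) := by
        rw [mul_pow]; ring
    _ ≤ _ := by gcongr

/-- A pair is determined by its first set and the symmetric difference, which has size `2 (w -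
overlap c) < 2 θ`. -/
theorem card_badTuples_one_le (n w : ℕ) (θ : ℝ) :
    #(badTuples n w 1 θ) ≤ n.choose w * ballCard n ⌊2 * θ⌋₊ := by
  have h : #(powersetCard w (univ : Finset (Fin n))) = n.choose w := by simp
  rw [← h, ballCard, ← card_product]
  refine card_le_card_of_injOn (fun c => (c 0, c 0 ∆ c 1)) ?_ ?_
  · intro c hc
    simp only [badTuples, coe_filter, Set.mem_ofPred_eq, Fintype.mem_piFinset] at hc
    simp only [coe_product, Set.mem_prod, mem_coe, hc.1 0, true_and, mem_filter, mem_univ]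
    have h1 := card_symmDiff_eq (c 0) (c 1)
    rw [(mem_powersetCard.1 (hc.1 0)).2, (mem_powersetCard.1 (hc.1 1)).2] at h1
    have h2 : overlap c = #(c 0 ∩ c 1) := by
      rw [overlap]; congr 1; ext i; simp [Fin.forall_fin_two]
    have h3 := hc.2
    rw [h2] at h3
    have h1' : (#(c 0 ∆ c 1) : ℝ) + 2 * #(c 0 ∩ c 1) = w + w := by exact_mod_cast h1
    exact Nat.le_floor (by linarith)
  · intro c _ c' _ h
    simp only [Prod.mk.injEq] at h
    ext1 j
    have h2 := h.2
    rw [h.1] at h2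
    fin_cases j
    · exact h.1
    · exact symmDiff_right_injective _ h2

/-! ### Random choice and expurgation. -/

/-- A uniform `φ` restricted to distinct indices is uniform. Division is avoided by an injective
exchange: fresh values `ψ` replace those at `ι`, and the old ones are kept aside. -/
theorem card_comp_mem_mul_le {β : Type*} [DecidableEq β] (X : Finset β) {M l : ℕ}
    (B : Finset (Fin (l + 1) → β))
    {ι : Fin (l + 1) → Fin M} (hι : Function.Injective ι) :
    #{φ ∈ Fintype.piFinset (fun _ : Fin M => X) | φ ∘ ι ∈ B} * #X ^ (l + 1) ≤ #B * #X ^ M := by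
  have e1 : #X ^ (l + 1) = #(Fintype.piFinset fun _ : Fin (l + 1) => X) := by
    simp [Fintype.card_piFinset]
  have e2 : #X ^ M = #(Fintype.piFinset fun _ : Fin M => X) := by simp [Fintype.card_piFinset]
  rw [e1, e2, ← card_product, ← card_product]
  refine card_le_card_of_injOn (fun x => (x.1 ∘ ι, Function.extend ι x.2 x.1)) ?_ ?_
  · rintro ⟨φ, ψ⟩ h
    simp only [coe_product, Set.mem_prod, mem_coe, mem_filter, Fintype.mem_piFinset] at h ⊢
    refine ⟨h.1.2, fun a => ?_⟩
    by_cases ha : ∃ j, ι j = a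
    · obtain ⟨j, rfl⟩ := ha
      rw [hι.extend_apply]; exact h.2 j
    · rw [Function.extend_apply' _ _ _ ha]; exact h.1.1 a
  · rintro ⟨φ, ψ⟩ _ ⟨φ', ψ'⟩ _ h
    simp only [Prod.mk.injEq] at h
    have hψ : ψ = ψ' := by
      ext1 j
      have := congrFun h.2 (ι j)
      rwa [hι.extend_apply, hι.extend_apply] at this
    have hφ : φ = φ' := by
      ext1 a
      by_cases ha : ∃ j, ι j = a
      · obtain ⟨j, rfl⟩ := ha
        exact congrFun h.1 j
      · have := congrFun h.2 a
        rwa [Function.extend_apply' _ _ _ ha, Function.extend_apply' _ _ _ ha] at this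
    rw [hψ, hφ]

/-- Random choice of `M` elements followed by expurgation. -/
theorem exists_expurgated {β : Type*} [DecidableEq β] (X : Finset β) (hX : X.Nonempty) (M : ℕ)
    (I : Finset ℕ) (B : ∀ l, Finset (Fin (l + 1) → β))
    (h : ∑ l ∈ I, (M : ℝ) ^ (l + 1) * (#(B l) / (#X : ℝ) ^ (l + 1)) ≤ M / 2) :
    ∃ φ : Fin M → β, (∀ i, φ i ∈ X) ∧ ∃ G : Finset (Fin M), (M : ℝ) / 2 ≤ #G ∧
      ∀ l ∈ I, ∀ ι : Fin (l + 1) → Fin M, Function.Injective ι → (∀ j, ι j ∈ G) →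
        φ ∘ ι ∉ B l := by
  classical
  have hX0 : (0 : ℝ) < #X := by exact_mod_cast hX.card_pos
  let Ω := Fintype.piFinset fun _ : Fin M => X
  let J : ∀ l, (Fin M → β) → Finset (Fin (l + 1) → Fin M) := fun l φ =>
    {ι | Function.Injective ι ∧ φ ∘ ι ∈ B l}
  have hΩ : (#Ω : ℝ) = (#X : ℝ) ^ M := by simp [Ω, Fintype.card_piFinset]
  have hcount : ∑ φ ∈ Ω, (∑ l ∈ I, (#(J l φ) : ℝ)) ≤ ∑ φ ∈ Ω, (M : ℝ) / 2 := by
    rw [sum_comm, sum_const, nsmul_eq_mul, hΩ]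
    calc ∑ l ∈ I, ∑ φ ∈ Ω, (#(J l φ) : ℝ)
        ≤ ∑ l ∈ I, (#X : ℝ) ^ M * ((M : ℝ) ^ (l + 1) * (#(B l) / (#X : ℝ) ^ (l + 1))) := by
          refine sum_le_sum fun l _ => ?_
          have e : ∑ φ ∈ Ω, #(J l φ) = ∑ ι : Fin (l + 1) → Fin M,
              #{φ ∈ Ω | Function.Injective ι ∧ φ ∘ ι ∈ B l} :=
            sum_card_bipartiteAbove_eq_sum_card_bipartiteBelow
              (fun φ (ι : Fin (l + 1) → Fin M) => Function.Injective ι ∧ φ ∘ ι ∈ B l)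
          rw [← Nat.cast_sum, e, Nat.cast_sum]
          calc _ ≤ ∑ ι : Fin (l + 1) → Fin M, (#X : ℝ) ^ M * (#(B l) / (#X : ℝ) ^ (l + 1)) := by
                refine sum_le_sum fun ι _ => ?_
                by_cases hι : Function.Injective ι
                · have := card_comp_mem_mul_le X (B l) hι
                  simp only [hι, true_and]
                  rw [mul_div_assoc', le_div_iff₀ (by positivity), mul_comm ((#X : ℝ) ^ M)]
                  exact_mod_cast this
                · simp only [hι, false_and, filter_false, card_empty, Nat.cast_zero]
                  positivity
            _ = _ := by simp; ring
      _ = (#X : ℝ) ^ M * ∑ l ∈ I, (M : ℝ) ^ (l + 1) * (#(B l) / (#X : ℝ) ^ (l + 1)) := by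
          rw [mul_sum]
      _ ≤ _ := by gcongr
  obtain ⟨φ, hφ, hle⟩ := exists_le_of_sum_le
    (Fintype.piFinset_nonempty.2 fun _ => hX : Ω.Nonempty) hcount
  -- The first index of every bad tuple is deleted; by the choice of `φ` at most `M / 2` indices are
  -- lost.
  refine ⟨φ, Fintype.mem_piFinset.1 hφ, (I.biUnion fun l => (J l φ).image fun ι => ι 0)ᶜ, ?_, ?_⟩
  · have h1 : #(I.biUnion fun l => (J l φ).image fun ι => ι 0) ≤ ∑ l ∈ I, #(J l φ) :=
      card_biUnion_le.trans (sum_le_sum fun l _ => card_image_le)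
    have h1' : (#(I.biUnion fun l => (J l φ).image fun ι => ι 0) : ℝ) ≤ ∑ l ∈ I, (#(J l φ) : ℝ) := by
      exact_mod_cast h1
    have h2 := card_compl_add_card (I.biUnion fun l => (J l φ).image fun ι => ι 0)
    rw [Fintype.card_fin] at h2
    have h2' : (#((I.biUnion fun l => (J l φ).image fun ι => ι 0)ᶜ) : ℝ) +
      #(I.biUnion fun l => (J l φ).image fun ι => ι 0) = M := by exact_mod_cast h2
    linarith
  · intro l hl ι hι hG hbad
    have := hG 0
    simp only [mem_compl, mem_biUnion, mem_image, not_exists, not_and] at this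
    exact this l hl ι (by simp [J, hι, hbad]) rfl

/-- Any `l + 1` distinct members of the family have few common elements. -/
def Spread {n : ℕ} (C : Finset (Finset (Fin n))) (w l : ℕ) (θ : ℝ) : Prop :=
  ∀ S ⊆ C, #S = l + 1 → (#{i | ∀ A ∈ S, i ∈ A} : ℝ) + θ ≤ w

theorem Spread.mono {n w l l' : ℕ} {θ : ℝ} {C : Finset (Finset (Fin n))} (h : Spread C w l θ)
    (hl : l ≤ l') : Spread C w l' θ := by
  intro S hS hc
  obtain ⟨S', hS', hc'⟩ := exists_subset_card_eq (s := S) (n := l + 1) (by omega)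
  refine le_trans ?_ (h S' (hS'.trans hS) hc')
  gcongr with i hi

theorem exists_spread_code {n w M : ℕ} (hw : w ≤ n) (I : Finset ℕ) (h1 : 1 ∈ I) (θ : ℕ → ℝ)
    (hθ : 0 < θ 1)
    (h : ∑ l ∈ I, (M : ℝ) ^ (l + 1) * (#(badTuples n w l (θ l)) / (n.choose w : ℝ) ^ (l + 1)) ≤
      M / 2) :
    ∃ C : Finset (Finset (Fin n)), (∀ A ∈ C, #A = w) ∧ (M : ℝ) / 2 ≤ #C ∧
      ∀ l ∈ I, Spread C w l (θ l) := by
  classical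
  have hX : #(powersetCard w (univ : Finset (Fin n))) = n.choose w := by simp
  obtain ⟨φ, hφ, G, hG, hgood⟩ := exists_expurgated (powersetCard w (univ : Finset (Fin n)))
    (card_pos.1 (hX ▸ Nat.choose_pos hw)) M I (fun l => badTuples n w l (θ l))
    (by rw [hX]; exact h)
  have hw' : ∀ i, #(φ i) = w := fun i => (mem_powersetCard.1 (hφ i)).2
  have hgood' : ∀ l ∈ I, ∀ ι : Fin (l + 1) → Fin M, Function.Injective ι → (∀ j, ι j ∈ G) →
      (overlap (φ ∘ ι) : ℝ) + θ l ≤ w := by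
    intro l hl ι hι hιG
    have := hgood l hl ι hι hιG
    simp only [badTuples, mem_filter, Fintype.mem_piFinset, not_and, not_lt] at this
    exact this fun j => hφ _
  -- Equal sets at two indices would form a pair with overlap `w`, which `θ 1 > 0` forbids.
  have hinj : Set.InjOn φ G := by
    intro a ha b hb hab
    by_contra hne
    have := hgood' 1 h1 ![a, b] (by
      intro x y hxy
      fin_cases x <;> fin_cases y <;> simp_all) (by
      intro j; fin_cases j <;> simpa)
    have e : overlap (φ ∘ ![a, b]) = w := by
      rw [overlap, ← hw' a]
      congr 1
      ext i
      simp [Fin.forall_fin_two, ← hab]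
    rw [e] at this
    linarith
  refine ⟨G.image φ, ?_, by rwa [card_image_of_injOn hinj], ?_⟩
  · intro A hA
    obtain ⟨i, -, rfl⟩ := mem_image.1 hA
    exact hw' i
  · intro l hl S hS hc
    have e := S.equivFinOfCardEq hc
    have hpre : ∀ j : Fin (l + 1), ∃ a ∈ G, φ a = (e.symm j).1 := fun j =>
      mem_image.1 (hS (e.symm j).2)
    choose ι hι hφι using hpre
    have := hgood' l hl ι (fun x y hxy => by
      apply e.symm.injective
      apply Subtype.ext
      rw [← hφι, ← hφι, hxy]) hι
    have e' : overlap (φ ∘ ι) = #{i | ∀ A ∈ S, i ∈ A} := by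
      rw [overlap]
      congr 1
      ext i
      simp only [mem_filter, mem_univ, true_and, Function.comp, hφι]
      constructor
      · intro h A hA
        have := h (e ⟨A, hA⟩)
        simpa using this
      · intro h j
        exact h _ (e.symm j).2
    rwa [e'] at this

/-! ### Asymptotics of the first-stage codes. -/

open Filter Topology

theorem tendsto_log_succ_div : Tendsto (fun n : ℕ => Real.log (n + 1) / n) atTop (𝓝 0) := by
  have h := (Real.tendsto_pow_log_div_mul_add_atTop 1 (-1) 1 one_ne_zero).comp
    (tendsto_atTop_add_const_right atTop (1 : ℝ) tendsto_natCast_atTop_atTop)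
  refine h.congr fun n => ?_
  simp

theorem tendsto_floor_div {ω : ℝ} (h : 0 ≤ ω) :
    Tendsto (fun n : ℕ => ((⌊ω * n⌋₊ : ℕ) : ℝ) / n) atTop (𝓝 ω) :=
  (tendsto_nat_floor_mul_div_atTop h).comp tendsto_natCast_atTop_atTop

theorem floor_mul_le {ω : ℝ} (h1 : ω ≤ 1) (n : ℕ) : ⌊ω * n⌋₊ ≤ n :=
  Nat.floor_le_of_le (by nlinarith [Nat.cast_nonneg (α := ℝ) n])

theorem continuous_partitionSum (s : ℝ) (l : ℕ) : Continuous (partitionSum s l) := by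
  unfold partitionSum
  fun_prop

theorem pow_add_pow_le_partitionSum (s : ℝ) (l : ℕ) {ω : ℝ} (h0 : 0 ≤ ω) (h1 : ω ≤ 1) :
    ω ^ (l + 1) + (1 - ω) ^ (l + 1) ≤ partitionSum s l ω := by
  have : 0 ≤ 1 - ω := by linarith
  unfold partitionSum
  refine le_add_of_nonneg_right (sum_nonneg fun i _ => ?_)
  positivity

theorem partitionSum_pos (s : ℝ) (l : ℕ) {ω : ℝ} (h0 : 0 ≤ ω) (h1 : ω ≤ 1) :
    0 < partitionSum s l ω := by
  refine lt_of_lt_of_le ?_ (pow_add_pow_le_partitionSum s l h0 h1)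
  have : 0 ≤ 1 - ω := by linarith
  rcases h0.eq_or_lt with rfl | h
  · simp
  · positivity

theorem deltaFun_nonneg (s : ℝ) (l : ℕ) {ω : ℝ} (h0 : 0 ≤ ω) (h1 : ω ≤ 1) :
    0 ≤ deltaFun s l ω := by
  have : 0 ≤ 1 - ω := by linarith
  unfold deltaFun
  refine div_nonneg (sum_nonneg fun i _ => ?_) (partitionSum_pos s l h0 h1).le
  positivity

theorem tauStar_nonneg (R : ℝ) (l : ℕ) {ω : ℝ} (h0 : 0 ≤ ω) (h1 : ω ≤ 1) :
    0 ≤ tauStar R l ω := by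
  refine Real.sSup_nonneg ?_
  rintro d ⟨s, -, -, rfl⟩
  exact deltaFun_nonneg s l h0 h1

/-- Lowering the rate leaves room above `tauStar` in the exponent. -/
theorem exists_tauStar_lt {R R' ω : ℝ} {l : ℕ} (h0 : 0 ≤ ω) (h1 : ω ≤ 1) (hR : 0 ≤ R)
    (hR' : R' < R) (hl : 0 < l) (hT : 0 < tauStar R l ω) :
    ∃ s ρ : ℝ, 0 < s ∧ tauStar R l ω < ρ ∧ R' * l * Real.log 2 < gFun s l ω - s * ρ := by
  have hlog : 0 < Real.log 2 := Real.log_pos (by norm_num)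
  have hl' : (0 : ℝ) < l := by exact_mod_cast hl
  set T := tauStar R l ω with hTdef
  set G := -Real.log (ω ^ (l + 1) + (1 - ω) ^ (l + 1)) with hG
  have hp0 : 0 < ω ^ (l + 1) + (1 - ω) ^ (l + 1) := by
    have : 0 ≤ 1 - ω := by linarith
    rcases h0.eq_or_lt with rfl | h
    · simp
    · positivity
  have hG0 : 0 ≤ G := by
    have : 0 ≤ 1 - ω := by linarith
    have h2 : ω ^ (l + 1) ≤ ω := pow_le_of_le_one h0 h1 (by omega)
    have h3 : (1 - ω) ^ (l + 1) ≤ 1 - ω := pow_le_of_le_one this (by linarith) (by omega)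
    have := Real.log_nonpos hp0.le (by linarith)
    linarith
  -- For the `s` chosen below, `s * (T / 2) ≤ s * deltaFun s l ω ≤ G`. Raising the threshold by `κ`
  -- thus costs less than `(R - R') * l * log 2`; `G + 1` keeps the denominator positive and the
  -- bound strict.
  set κ := (R - R') * l * Real.log 2 * T / (2 * (G + 1)) with hκ
  have hκ0 : 0 < κ := by
    have : 0 < R - R' := by linarith
    positivity
  set A := {d : ℝ | ∃ s : ℝ, 0 < s ∧ R * l * Real.log 2 ≤ gFun s l ω - s * deltaFun s l ω ∧
    d = deltaFun s l ω} with hA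
  have hTA : T = sSup A := rfl
  have hne : A.Nonempty := by
    by_contra h
    rw [Set.not_nonempty_iff_eq_empty] at h
    rw [hTA, h, Real.sSup_empty] at hT
    exact lt_irrefl _ hT
  obtain ⟨d, ⟨s, hs, hsR, rfl⟩, hd⟩ := exists_lt_of_lt_csSup hne
    (show max (T / 2) (T - κ) < sSup A from hTA ▸ max_lt (by linarith) (by linarith))
  have hd1 := (le_max_left _ _).trans_lt hd
  have hd2 := (le_max_right _ _).trans_lt hd
  refine ⟨s, deltaFun s l ω + κ, hs, by linarith, ?_⟩
  have hgG : gFun s l ω ≤ G := by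
    rw [gFun, hG]
    exact neg_le_neg (Real.log_le_log hp0 (pow_add_pow_le_partitionSum s l h0 h1))
  have hsd : s * (T / 2) < G + 1 := by
    have : s * (T / 2) ≤ s * deltaFun s l ω := by gcongr
    have : 0 ≤ R * l * Real.log 2 := by positivity
    linarith
  have hsκ : s * κ < (R - R') * l * Real.log 2 := by
    have h4 : 0 < (R - R') * l * Real.log 2 := by
      have : 0 < R - R' := by linarith
      positivity
    calc s * κ = (R - R') * l * Real.log 2 * (s * (T / 2)) / (G + 1) := by
          rw [hκ]; field_simp
      _ < (R - R') * l * Real.log 2 * (G + 1) / (G + 1) := by gcongr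
      _ = _ := by field_simp
  nlinarith

theorem eventually_card_badTuples_le {R' ω s ρ : ℝ} {l : ℕ} (h0 : 0 ≤ ω) (h1 : ω ≤ 1)
    (hs : 0 < s) (h : R' * l * Real.log 2 < gFun s l ω - s * ρ) :
    ∃ c > 0, ∀ᶠ n : ℕ in atTop, (#(badTuples n ⌊ω * n⌋₊ l (ρ * n)) : ℝ) ≤
      (n.choose ⌊ω * n⌋₊ : ℝ) ^ (l + 1) * Real.exp (-(n * (R' * l * Real.log 2 + c))) := by
  obtain ⟨c, hc0, hc⟩ : ∃ c > 0, R' * l * Real.log 2 + c < gFun s l ω - s * ρ :=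
    ⟨(gFun s l ω - s * ρ - R' * l * Real.log 2) / 2, by linarith, by linarith⟩
  refine ⟨c, hc0, ?_⟩
  have hlim : Tendsto (fun n : ℕ => (l + 1) * (Real.log (n + 1) / n) +
      Real.log (partitionSum s l ((⌊ω * n⌋₊ : ℕ) / n)) + s * ρ) atTop
      (𝓝 ((l + 1) * 0 + Real.log (partitionSum s l ω) + s * ρ)) := by
    refine ((tendsto_log_succ_div.const_mul _).add ?_).add_const _
    exact (((continuous_partitionSum s l).tendsto ω).comp (tendsto_floor_div h0)).log
      (partitionSum_pos s l h0 h1).ne'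
  have hev := hlim.eventually_lt_const
    (show _ < -(R' * l * Real.log 2 + c) by rw [gFun] at hc; linarith)
  filter_upwards [hev, eventually_gt_atTop 0] with n hn hn0
  have hn' : (0 : ℝ) < n := by exact_mod_cast hn0
  have hw := floor_mul_le h1 n
  refine (card_badTuples_le hn0 hw l (ρ * n) hs).trans ?_
  set w := ⌊ω * n⌋₊
  have hp1 : (w : ℝ) / n ≤ 1 := by rw [div_le_one hn']; exact_mod_cast hw
  have hZ := partitionSum_pos s l (by positivity : (0 : ℝ) ≤ (w : ℝ) / n) hp1
  rw [mul_comm ((n : ℝ) + 1), mul_pow, mul_assoc]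
  gcongr ?_ * ?_
  have e1 : ((n : ℝ) + 1) ^ (l + 1) = Real.exp ((l + 1 : ℕ) * Real.log (n + 1)) := by
    rw [Real.exp_nat_mul, Real.exp_log (by positivity)]
  have e2 : partitionSum s l (w / n) ^ n = Real.exp (n * Real.log (partitionSum s l (w / n))) := by
    rw [Real.exp_nat_mul, Real.exp_log hZ]
  rw [e1, e2, ← Real.exp_add, ← Real.exp_add]
  refine Real.exp_le_exp.2 ?_
  have := mul_le_mul_of_nonneg_left hn.le hn'.le
  calc _ = (n : ℝ) * ((l + 1) * (Real.log (n + 1) / n) + Real.log (partitionSum s l (w / n)) +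
        s * ρ) := by push_cast; field_simp; ring
    _ ≤ _ := this
    _ = _ := by ring

/-- Replaces the Chernoff argument when `tauStar R 1 ω = 0`. Pairs at distance below `2 ρ n` have a
fraction of about `exp (-n (h(ω) - h(2ρ)))`, with natural entropies, which suffices for small `ρ` at
any rate below the entropy. -/
theorem eventually_card_badPairs_le {R' ω : ℝ} (h0 : 0 ≤ ω) (h1 : ω ≤ 1)
    (h : R' * Real.log 2 < Real.binEntropy ω) :
    ∃ ρ > 0, ∃ c > 0, ∀ᶠ n : ℕ in atTop, (#(badTuples n ⌊ω * n⌋₊ 1 (ρ * n)) : ℝ) ≤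
      (n.choose ⌊ω * n⌋₊ : ℝ) ^ 2 * Real.exp (-(n * (R' * Real.log 2 + c))) := by
  -- One third bounds the entropy of the ball, one becomes `c`, and one leaves room in the limit.
  set κ := (Real.binEntropy ω - R' * Real.log 2) / 3 with hκ
  have hκ0 : 0 < κ := by simp only [hκ]; linarith
  obtain ⟨ρ, hρ0, hρ1, hρ⟩ : ∃ ρ > 0, 2 * ρ ≤ 1 / 2 ∧ Real.binEntropy (2 * ρ) < κ := by
    have hlim : Tendsto (fun ρ : ℝ => Real.binEntropy (2 * ρ)) (𝓝[>] 0) (𝓝 0) := by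
      have : Continuous fun ρ : ℝ => Real.binEntropy (2 * ρ) := by fun_prop
      have h := this.tendsto 0
      simp only [mul_zero, Real.binEntropy_zero] at h
      exact h.mono_left nhdsWithin_le_nhds
    have h2 : ∀ᶠ ρ : ℝ in 𝓝[>] 0, ρ < 1 / 4 :=
      (eventually_lt_nhds (by norm_num)).filter_mono nhdsWithin_le_nhds
    obtain ⟨ρ, h3, h4, h5⟩ :=
      ((hlim.eventually_lt_const hκ0).and (h2.and self_mem_nhdsWithin)).exists
    exact ⟨ρ, h5, by linarith, h3⟩
  refine ⟨ρ, hρ0, κ, hκ0, ?_⟩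
  have hlim : Tendsto (fun n : ℕ => Real.binEntropy ((⌊ω * n⌋₊ : ℕ) / n) - Real.log (n + 1) / n)
      atTop (𝓝 (Real.binEntropy ω - 0)) :=
    ((Real.binEntropy_continuous.tendsto ω).comp (tendsto_floor_div h0)).sub tendsto_log_succ_div
  have hev := hlim.eventually_const_lt
    (show R' * Real.log 2 + κ + κ < _ by simp only [hκ]; linarith)
  filter_upwards [hev, eventually_gt_atTop 0] with n hn hn0
  have hn' : (0 : ℝ) < n := by exact_mod_cast hn0
  have hw := floor_mul_le h1 n
  set w := ⌊ω * n⌋₊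
  have hb := card_badTuples_one_le n w (ρ * n)
  have hball := ballCard_le_exp n ⌊2 * (ρ * n)⌋₊ (by positivity : 0 < 2 * ρ) hρ1
    ((Nat.floor_le (by positivity)).trans_eq (by ring))
  have hC := exp_binEntropy_le_choose hw
  have hC' : Real.exp (n * (R' * Real.log 2 + κ + κ)) ≤ n.choose w := by
    have h6 : Real.exp (n * (R' * Real.log 2 + κ + κ)) * (n + 1) ≤ (n + 1) * n.choose w := by
      refine le_trans ?_ hC
      have h7 : (n : ℝ) + 1 = Real.exp (Real.log (n + 1)) :=
        (Real.exp_log (by positivity)).symm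
      rw [h7, ← Real.exp_add, Real.exp_le_exp]
      have := mul_le_mul_of_nonneg_left hn.le hn'.le
      rw [mul_sub, mul_div_cancel₀ _ hn'.ne'] at this
      linarith
    rw [mul_comm] at h6
    exact le_of_mul_le_mul_left h6 (by positivity)
  calc (#(badTuples n w 1 (ρ * n)) : ℝ) ≤ n.choose w * ballCard n ⌊2 * (ρ * n)⌋₊ := by
        exact_mod_cast hb
    _ ≤ n.choose w * Real.exp (n * κ) := by
        gcongr
        refine hball.trans (Real.exp_le_exp.2 ?_)
        gcongr
    _ = n.choose w * (Real.exp (n * (R' * Real.log 2 + κ + κ)) *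
          Real.exp (-(n * (R' * Real.log 2 + κ)))) := by
        rw [← Real.exp_add]; congr 2; ring
    _ ≤ n.choose w * (n.choose w * Real.exp (-(n * (R' * Real.log 2 + κ)))) := by gcongr
    _ = _ := by ring

/-- Existence of the first-stage codes. -/
theorem exists_firstStage {R R' ω : ℝ} {Lup : ℕ} (hLup : 0 < Lup) (h0 : 0 ≤ ω) (h1 : ω ≤ 1)
    (hR'0 : 0 ≤ R') (hR' : R' < R) (hR : R ≤ entropy ω) :
    ∃ ρ : ℕ → ℝ, (∀ l ∈ Icc 1 Lup, tauStar R l ω < ρ l) ∧ ∀ᶠ n : ℕ in atTop,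
      ∃ C : Finset (Finset (Fin n)), (∀ A ∈ C, #A = ⌊ω * n⌋₊) ∧
        Real.exp (n * (R' * Real.log 2)) ≤ #C ∧
        ∀ l ∈ Icc 1 Lup, Spread C ⌊ω * n⌋₊ l (ρ l * n) := by
  classical
  have hlog : 0 < Real.log 2 := Real.log_pos (by norm_num)
  -- If `l > 1` and `tauStar R l ω = 0`, the spread of pairs already suffices, with `ρ 1` as
  -- threshold.
  let I := {l ∈ Icc 1 Lup | l = 1 ∨ 0 < tauStar R l ω}
  have hbad : ∀ l ∈ I, ∃ ρ : ℝ, tauStar R l ω < ρ ∧ ∃ c > 0, ∀ᶠ n : ℕ in atTop,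
      (#(badTuples n ⌊ω * n⌋₊ l (ρ * n)) : ℝ) ≤
      (n.choose ⌊ω * n⌋₊ : ℝ) ^ (l + 1) * Real.exp (-(n * (R' * l * Real.log 2 + c))) := by
    intro l hl
    simp only [I, mem_filter, mem_Icc] at hl
    rcases (tauStar_nonneg R l h0 h1).eq_or_lt with hT | hT
    · obtain rfl : l = 1 := by
        rcases hl.2 with h | h
        · exact h
        · exact absurd hT h.ne
      have hR2 : R * Real.log 2 ≤ Real.binEntropy ω := by
        rwa [entropy, le_div_iff₀ hlog] at hR
      obtain ⟨ρ, hρ, c, hc, h⟩ := eventually_card_badPairs_le (R' := R') h0 h1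
        ((mul_lt_mul_of_pos_right hR' hlog).trans_le hR2)
      refine ⟨ρ, hT ▸ hρ, c, hc, ?_⟩
      simpa using h
    · obtain ⟨s, ρ, hs, hρ, h⟩ := exists_tauStar_lt h0 h1 (hR'0.trans hR'.le) hR' hl.1.1 hT
      exact ⟨ρ, hρ, eventually_card_badTuples_le h0 h1 hs h⟩
  choose! ρ hρ c hc hev using hbad
  have h1I : 1 ∈ I := by simp [I]; omega
  have hρ1 : 0 < ρ 1 := (tauStar_nonneg R 1 h0 h1).trans_lt (hρ 1 h1I)
  refine ⟨fun l => if l ∈ I then ρ l else ρ 1, ?_, ?_⟩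
  · intro l hl
    by_cases h : l ∈ I
    · simp only [h, if_true]; exact hρ l h
    · simp only [h, if_false]
      have : ¬ 0 < tauStar R l ω := fun h' => h (by simp only [I, mem_filter]; exact ⟨hl, Or.inr h'⟩)
      linarith
  have hsmall : Tendsto (fun n : ℕ => ∑ l ∈ I, (4 : ℝ) ^ l * Real.exp (-(n * c l))) atTop
      (𝓝 (∑ l ∈ I, (4 : ℝ) ^ l * 0)) := by
    refine tendsto_finsetSum _ fun l hl => Tendsto.const_mul _ ?_
    exact Real.tendsto_exp_neg_atTop_nhds_zero.comp
      (tendsto_natCast_atTop_atTop.atTop_mul_const (hc l hl))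
  have hev2 := hsmall.eventually_lt_const (show _ < (1 / 2 : ℝ) by simp)
  have hevI : ∀ᶠ n : ℕ in atTop, ∀ l ∈ I, (#(badTuples n ⌊ω * n⌋₊ l (ρ l * n)) : ℝ) ≤
      (n.choose ⌊ω * n⌋₊ : ℝ) ^ (l + 1) * Real.exp (-(n * (R' * l * Real.log 2 + c l))) :=
    (eventually_all_finset I).2 hev
  filter_upwards [hev2, hevI, eventually_gt_atTop 0] with n hn hnI hn0
  have hn' : (0 : ℝ) < n := by exact_mod_cast hn0
  have hw := floor_mul_le h1 n
  set w := ⌊ω * n⌋₊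
  set E := Real.exp (n * (R' * Real.log 2)) with hE
  have hE1 : 1 ≤ E := Real.one_le_exp (by positivity)
  -- The factor 2 compensates for expurgation, which may discard half of the words.
  set M := 2 * ⌈E⌉₊ with hM
  have hM4 : (M : ℝ) ≤ 4 * E := by
    have := (Nat.ceil_lt_add_one (by linarith : 0 ≤ E)).le
    rw [hM]; push_cast; linarith
  have hM2 : E ≤ (M : ℝ) / 2 := by
    have := Nat.le_ceil E
    rw [hM]; push_cast; linarith
  have hX : (0 : ℝ) < n.choose w := by exact_mod_cast Nat.choose_pos hw
  obtain ⟨C, hCw, hCM, hC⟩ := exists_spread_code (M := M) hw I h1I (fun l => ρ l * n)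
    (by positivity) (by
      calc ∑ l ∈ I, (M : ℝ) ^ (l + 1) *
            (#(badTuples n w l (ρ l * n)) / (n.choose w : ℝ) ^ (l + 1))
          ≤ ∑ l ∈ I, M * ((4 : ℝ) ^ l * Real.exp (-(n * c l))) := by
            refine sum_le_sum fun l hl => ?_
            calc _ ≤ (M : ℝ) ^ (l + 1) * Real.exp (-(n * (R' * l * Real.log 2 + c l))) := by
                  gcongr
                  rw [div_le_iff₀ (by positivity), mul_comm (Real.exp _)]
                  exact hnI l hl
              _ = M * ((M : ℝ) ^ l * Real.exp (-(n * (R' * l * Real.log 2 + c l)))) := by ring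
              _ ≤ M * ((4 * E) ^ l * Real.exp (-(n * (R' * l * Real.log 2 + c l)))) := by gcongr
              _ = M * (4 ^ l * Real.exp (-(n * c l))) := by
                  rw [mul_pow, hE, ← Real.exp_nat_mul, mul_assoc, ← Real.exp_add]
                  congr 4; ring
        _ = M * ∑ l ∈ I, (4 : ℝ) ^ l * Real.exp (-(n * c l)) := by rw [mul_sum]
        _ ≤ M * (1 / 2) := by gcongr
        _ = _ := by ring)
  refine ⟨C, hCw, hM2.trans hCM, fun l hl => ?_⟩
  by_cases h : l ∈ I
  · simp only [h, if_true]; exact hC l h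
  · simp only [h, if_false]; exact (hC 1 h1I).mono (mem_Icc.1 hl).1

/-! ### The two-stage protocol and its list sizes. -/

/-- The set of positions of the ones of a binary word. -/
def support {n : ℕ} (x : Fin n → Bool) : Finset (Fin n) := {i | x i = true}

/-- The indicator word of a set. -/
def word {n : ℕ} (A : Finset (Fin n)) : Fin n → Bool := fun i => decide (i ∈ A)

@[simp] theorem support_word {n : ℕ} (A : Finset (Fin n)) : support (word A) = A := by
  ext; simp [support, word]

theorem support_injective (n : ℕ) : Function.Injective (support (n := n)) := by
  intro x y h
  ext1 i
  have := congrArg (fun S => i ∈ S) h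
  simp only [support, mem_filter, mem_univ, true_and, eq_iff_iff] at this
  exact Bool.eq_iff_iff.2 this

theorem Delta_eq_card_sdiff {n : ℕ} (x y : Fin n → Bool) :
    Delta x y = #(support x \ support y) := by
  rw [Delta]; congr 1; ext; simp [support]

theorem HasCode.exists_encoder {n K r : ℕ} (h : HasCode n K r) {β : Type*} [DecidableEq β]
    (S : Finset β) (hS : #S ≤ K) : ∃ enc : β → Finset (Fin n), ∀ a ∈ S, ∀ b ∈ S, a ≠ b →
      r < max #(enc a \ enc b) #(enc b \ enc a) := by
  obtain ⟨C, hK, hC⟩ := h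
  obtain ⟨C', hC', hc⟩ := exists_subset_card_eq (hS.trans hK)
  let e : S ≃ C' := Finset.equivOfCardEq hc.symm
  refine ⟨fun a => if h : a ∈ S then e ⟨a, h⟩ else ∅, fun a ha b hb hab => ?_⟩
  simp only [ha, hb, dif_pos]
  refine hC _ (hC' (e _).2) _ (hC' (e _).2) fun h => hab ?_
  simpa using e.injective (Subtype.ext h)

theorem twoStageAchievable_of_hasCode {n₁ n₂ t w : ℕ} (C : Finset (Finset (Fin n₁)))
    (hw : ∀ A ∈ C, #A = w) (hne : C.Nonempty)
    (h : ∀ Y : Finset (Fin n₁), #Y ≤ w → w - #Y ≤ t →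
      HasCode n₂ #{A ∈ C | Y ⊆ A} (t - (w - #Y))) :
    TwoStageAchievable n₁ n₂ t #C := by
  classical
  have henc : ∀ Y : Finset (Fin n₁), ∃ enc : Finset (Fin n₁) → Finset (Fin n₂),
      #Y ≤ w → w - #Y ≤ t → ∀ A ∈ C, ∀ B ∈ C, Y ⊆ A → Y ⊆ B → A ≠ B →
        t - (w - #Y) < max #(enc A \ enc B) #(enc B \ enc A) := by
    intro Y
    by_cases hY : #Y ≤ w ∧ w - #Y ≤ t
    · obtain ⟨enc, henc⟩ := (h Y hY.1 hY.2).exists_encoder {A ∈ C | Y ⊆ A} le_rfl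
      exact ⟨enc, fun _ _ A hA B hB hYA hYB => henc A (mem_filter.2 ⟨hA, hYA⟩) B
        (mem_filter.2 ⟨hB, hYB⟩)⟩
    · exact ⟨fun _ => ∅, fun h1 h2 => absurd ⟨h1, h2⟩ hY⟩
  choose enc henc using henc
  let e : Fin #C ≃ C := C.equivFin.symm
  let f : Fin #C → Fin n₁ → Bool := fun m => word (e m).1
  let g : Fin #C → (Fin n₁ → Bool) → Fin n₂ → Bool := fun m y => word (enc (support y) (e m).1)
  have huniq : ∀ m m' y, y ∈ outputs f g t m → y ∈ outputs f g t m' → m = m' := by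
    rintro m m' ⟨y₁, y₂⟩ ⟨h1, h2, h3⟩ ⟨h1', h2', h3'⟩
    simp only [f, g, Delta_eq_card_sdiff, support_word, card_eq_zero, sdiff_eq_empty_iff_subset]
      at h1 h2 h3 h1' h2' h3'
    by_contra hmm
    have hA := hw _ (e m).2
    have hA' := hw _ (e m').2
    have hne : (e m).1 ≠ (e m').1 := fun h => hmm (e.injective (Subtype.ext h))
    have c1 := card_sdiff_of_subset h1
    have c1' := card_sdiff_of_subset h1'
    rw [c1, hA] at h3
    rw [c1', hA'] at h3'
    have := henc (support y₁) (hA ▸ card_le_card h1) (by omega) _ (e m).2 _ (e m').2 h1 h1' hne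
    -- Since `y₂` lies below both second-stage words, every point of one word missing from the other
    -- counts as an error.
    have d1 := card_le_card (sdiff_subset_sdiff (Subset.refl (enc (support y₁) (e m).1)) h2')
    have d2 := card_le_card (sdiff_subset_sdiff (Subset.refl (enc (support y₁) (e m').1)) h2)
    rcases lt_max_iff.1 this with h | h <;> omega
  have hpos : 0 < #C := hne.card_pos
  refine ⟨f, g, fun y => if hy : ∃ m, y ∈ outputs f g t m then hy.choose else ⟨0, hpos⟩, ?_⟩
  intro m y hy
  have hex : ∃ m, y ∈ outputs f g t m := ⟨m, hy⟩
  simp only [dif_pos hex]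
  exact huniq _ _ y hex.choose_spec hy

theorem Spread.card_list_le {n w l : ℕ} {θ : ℝ} {C : Finset (Finset (Fin n))}
    (h : Spread C w l θ) (Y : Finset (Fin n)) (hY : (w : ℝ) < #Y + θ) :
    #{A ∈ C | Y ⊆ A} ≤ l := by
  by_contra hcon
  obtain ⟨S, hS, hc⟩ := exists_subset_card_eq (Nat.succ_le_of_lt (not_le.1 hcon))
  have h1 := h S (hS.trans (filter_subset _ _)) hc
  have h2 : #Y ≤ #{i | ∀ A ∈ S, i ∈ A} := by
    refine card_le_card fun i hi => ?_
    simp only [mem_filter, mem_univ, true_and]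
    exact fun A hA => (mem_filter.1 (hS hA)).2 hi
  have h2' : (#Y : ℝ) ≤ #{i | ∀ A ∈ S, i ∈ A} := by exact_mod_cast h2
  linarith

theorem Spread.le_card_sdiff {n w : ℕ} {θ : ℝ} {C : Finset (Finset (Fin n))}
    (h : Spread C w 1 θ) (hw : ∀ A ∈ C, #A = w) {A B : Finset (Fin n)} (hA : A ∈ C) (hB : B ∈ C)
    (hAB : A ≠ B) : θ ≤ #(A \ B) := by
  have h1 := h {A, B} (by intro X; simp; rintro (rfl | rfl) <;> assumption) (card_pair hAB)
  have h2 : #{i | ∀ X ∈ ({A, B} : Finset (Finset (Fin n))), i ∈ X} = #(A ∩ B) := by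
    congr 1; ext; simp
  rw [h2] at h1
  have h3 := card_sdiff_add_card_inter A B
  rw [hw A hA] at h3
  have h3' : (#(A \ B) : ℝ) + #(A ∩ B) = w := by exact_mod_cast h3
  linarith

/-- All listed codewords contain `Y`, so deleting `Y` leaves sets of size `w - #Y` on `N` points
with unchanged differences. -/
theorem Spread.card_list_mul_choose_le {n w m : ℕ} {θ : ℝ} {C : Finset (Finset (Fin n))}
    (h : Spread C w 1 θ) (hw : ∀ A ∈ C, #A = w) (Y : Finset (Fin n)) {N : ℕ} (hN : N + #Y = n)
    (hmN : 2 * m ≤ N) (hm : (m : ℝ) * (N - m) < θ * N) :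
    #{A ∈ C | Y ⊆ A} * N.choose m ≤ (N + 1) ^ 3 * max (N.choose (w - #Y)) (N.choose m) := by
  classical
  have hcard : Fintype.card {i // i ∉ Y} = N := by
    rw [Fintype.card_subtype_compl, Fintype.card_coe, Fintype.card_fin]; omega
  let E : {i // i ∉ Y} ≃ Fin N := Fintype.equivFinOfCardEq hcard
  let f : Finset (Fin n) → Finset (Fin N) := fun A => (A.subtype (· ∉ Y)).map E.toEmbedding
  have hmem : ∀ A j, j ∈ f A ↔ (E.symm j).1 ∈ A := by
    intro A j
    simp only [f, mem_map_equiv, mem_subtype]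
  have hfc : ∀ A, #(f A) = #(A \ Y) := by
    intro A
    simp only [f, card_map, card_subtype]
    congr 1; ext; simp
  have hinj : Set.InjOn f ({A ∈ C | Y ⊆ A} : Finset _) := by
    intro A hA B hB hAB
    simp only [coe_filter, Set.mem_ofPred_eq] at hA hB
    ext i
    by_cases hi : i ∈ Y
    · simp [hA.2 hi, hB.2 hi]
    · have h1 := hmem A (E ⟨i, hi⟩)
      have h2 := hmem B (E ⟨i, hi⟩)
      rw [hAB] at h1
      simpa using h1.symm.trans h2
  rw [← card_image_of_injOn hinj]
  refine card_constantWeight_le (d := ⌈θ⌉₊) _ ?_ ?_ hmN ?_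
  · intro A' hA'
    obtain ⟨A, hA, rfl⟩ := mem_image.1 hA'
    rw [mem_filter] at hA
    rw [hfc, card_sdiff_of_subset hA.2, hw A hA.1]
  · intro A' hA' B' hB' hne
    obtain ⟨A, hA, rfl⟩ := mem_image.1 hA'
    obtain ⟨B, hB, rfl⟩ := mem_image.1 hB'
    rw [mem_filter] at hA hB
    have h1 := h.le_card_sdiff hw hA.1 hB.1 fun hAB => hne (hAB ▸ rfl)
    have h2 : f A \ f B = f (A \ B) := by
      ext j; simp [hmem, Finset.mem_sdiff]
    have h3 : (A \ B) \ Y = A \ B := by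
      ext i
      simp only [Finset.mem_sdiff]
      constructor
      · exact fun h => h.1
      · exact fun h => ⟨h, fun hi => h.2 (hB.2 hi)⟩
    rw [h2, hfc, h3]
    exact Nat.ceil_le.2 h1
  · have h1 : θ * N ≤ ⌈θ⌉₊ * N := by gcongr; exact Nat.le_ceil θ
    have h2 := hm.trans_le h1
    exact_mod_cast h2

theorem Spread.card_list_le_exp {n w m : ℕ} {θ : ℝ} {C : Finset (Finset (Fin n))}
    (h : Spread C w 1 θ) (hw : ∀ A ∈ C, #A = w) (Y : Finset (Fin n)) {N : ℕ} (hN : N + #Y = n)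
    (hk : w - #Y ≤ N) (hmN : 2 * m ≤ N) (hm : (m : ℝ) * (N - m) < θ * N) :
    (#{A ∈ C | Y ⊆ A} : ℝ) ≤ ((N : ℝ) + 1) ^ 4 * Real.exp (N *
      max 0 (Real.binEntropy ((w - #Y : ℕ) / N) - Real.binEntropy (m / N))) := by
  have h1 := h.card_list_mul_choose_le hw Y hN hmN hm
  set k := w - #Y
  set F := #{A ∈ C | Y ⊆ A}
  have h1' : (F : ℝ) * N.choose m ≤ ((N : ℝ) + 1) ^ 3 * max (N.choose k : ℝ) (N.choose m) := by
    exact_mod_cast h1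
  have h2 := choose_le_exp_binEntropy hk
  have h3 := exp_binEntropy_le_choose (show m ≤ N by omega)
  have h4 := choose_le_exp_binEntropy (show m ≤ N by omega)
  set a := Real.binEntropy (k / N)
  set b := Real.binEntropy (m / N)
  have hN0 : (0 : ℝ) ≤ N := Nat.cast_nonneg N
  have h5 : max (N.choose k : ℝ) (N.choose m) ≤ Real.exp (N * b) * Real.exp (N * max 0 (a - b)) := by
    rw [← Real.exp_add]
    refine max_le (h2.trans (Real.exp_le_exp.2 ?_)) (h4.trans (Real.exp_le_exp.2 ?_))
    · rw [← mul_add]; gcongr; linarith [le_max_right 0 (a - b)]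
    · rw [← mul_add]; gcongr; linarith [le_max_left 0 (a - b)]
  refine le_of_mul_le_mul_right ?_ (Real.exp_pos (N * b))
  calc (F : ℝ) * Real.exp (N * b) ≤ F * ((N + 1) * N.choose m) := by gcongr
    _ = (N + 1) * (F * N.choose m) := by ring
    _ ≤ (N + 1) * (((N : ℝ) + 1) ^ 3 * (Real.exp (N * b) * Real.exp (N * max 0 (a - b)))) := by
      gcongr ?_ * ?_
      exact h1'.trans (by gcongr)
    _ = _ := by ring

/-! ### The thresholds `tauStar R 1 (1/2)` and `maxFraction`. -/

theorem partitionSum_one_half (s : ℝ) :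
    partitionSum s 1 (1 / 2) = (1 + Real.exp (-(s / 2))) / 2 := by
  have : -(s * 1 / (1 + 1)) = -(s / 2) := by ring
  simp only [partitionSum, Icc_self, sum_singleton, Nat.cast_one, this]
  norm_num
  ring

theorem deltaFun_one_half (s : ℝ) : deltaFun s 1 (1 / 2) =
    Real.exp (-(s / 2)) / (1 + Real.exp (-(s / 2))) / 2 := by
  have : -(s * 1 / (1 + 1)) = -(s / 2) := by ring
  have hu := Real.exp_pos (-(s / 2))
  rw [deltaFun, partitionSum_one_half]
  simp only [Icc_self, sum_singleton, Nat.cast_one, this]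
  norm_num
  field_simp

/-- With `u = exp (-s / 2)` one has `2 δ = u / (1 + u)`, so `s` parametrizes the Gilbert–Varshamov
curve at relative distance `2 δ`. -/
theorem gFun_sub_one_half (s : ℝ) : gFun s 1 (1 / 2) - s * deltaFun s 1 (1 / 2) =
    Real.log 2 - Real.binEntropy (2 * deltaFun s 1 (1 / 2)) := by
  rw [gFun, deltaFun_one_half, partitionSum_one_half]
  set u := Real.exp (-(s / 2)) with hu
  have hu0 : 0 < u := Real.exp_pos _
  have hs : s = -2 * Real.log u := by rw [hu, Real.log_exp]; ring
  have h1 : 1 - u / (1 + u) = 1 / (1 + u) := by field_simp; ring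
  rw [mul_div_cancel₀ _ (two_ne_zero), Real.binEntropy, h1, Real.log_inv, Real.log_inv,
    Real.log_div hu0.ne' (by positivity), Real.log_div one_ne_zero (by positivity),
    Real.log_div (by positivity) two_ne_zero, Real.log_one, hs]
  field_simp
  ring

theorem two_mul_deltaFun_half_lt {s : ℝ} (hs : 0 < s) : 2 * deltaFun s 1 (1 / 2) < 1 / 2 := by
  rw [deltaFun_one_half]
  have hu0 := Real.exp_pos (-(s / 2))
  have hu1 : Real.exp (-(s / 2)) < 1 := by simpa using hs
  rw [mul_div_cancel₀ _ (two_ne_zero), div_lt_div_iff₀ (by positivity) (by norm_num)]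
  linarith

theorem tauStar_half_le (R : ℝ) : tauStar R 1 (1 / 2) ≤ 1 / 4 := by
  refine Real.sSup_le ?_ (by norm_num)
  rintro d ⟨s, hs, -, rfl⟩
  linarith [two_mul_deltaFun_half_lt hs]

/-- The supremum need not be attained, so `y` is approached from the left. -/
theorem binEntropy_le_of_le_tauStar {R y : ℝ} (hy0 : 0 < y) (hy : y ≤ tauStar R 1 (1 / 2)) :
    Real.binEntropy (2 * y) ≤ (1 - R) * Real.log 2 := by
  have key : ∀ y' ∈ Set.Ioo 0 y, Real.binEntropy (2 * y') ≤ (1 - R) * Real.log 2 := by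
    intro y' hy'
    have hT : y' < tauStar R 1 (1 / 2) := hy'.2.trans_le hy
    rw [tauStar] at hT
    have hne : {d : ℝ | ∃ s : ℝ, 0 < s ∧ R * (1 : ℕ) * Real.log 2 ≤
        gFun s 1 (1 / 2) - s * deltaFun s 1 (1 / 2) ∧ d = deltaFun s 1 (1 / 2)}.Nonempty := by
      by_contra h
      rw [Set.not_nonempty_iff_eq_empty] at h
      rw [h, Real.sSup_empty] at hT
      exact lt_asymm hT hy'.1
    obtain ⟨d, ⟨s, hs, hR, rfl⟩, hd⟩ := exists_lt_of_lt_csSup hne hT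
    rw [gFun_sub_one_half, Nat.cast_one, mul_one] at hR
    have h1 := two_mul_deltaFun_half_lt hs
    have h2 := Real.binEntropy_strictMonoOn.monotoneOn
      (show 2 * y' ∈ Set.Icc (0 : ℝ) 2⁻¹ from ⟨by linarith [hy'.1], by norm_num; linarith⟩)
      (show 2 * deltaFun s 1 (1 / 2) ∈ Set.Icc (0 : ℝ) 2⁻¹ from
        ⟨by linarith [hy'.1], by norm_num; linarith⟩) (by linarith)
    linarith
  have hlim : Tendsto (fun y' : ℝ => Real.binEntropy (2 * y')) (𝓝[<] y)
      (𝓝 (Real.binEntropy (2 * y))) := by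
    have : Continuous fun y' : ℝ => Real.binEntropy (2 * y') := by fun_prop
    exact (this.tendsto y).mono_left nhdsWithin_le_nhds
  refine le_of_tendsto hlim ?_
  filter_upwards [Ioo_mem_nhdsLT hy0] with y' hy' using key y' hy'

theorem maxFraction_antitone : Antitone maxFraction := by
  intro L L' h
  refine iSup₂_le fun δ hδ => ?_
  obtain ⟨hδ0, n, hn, C, hC, hd⟩ := hδ
  obtain ⟨C', hC', hc⟩ := exists_subset_card_eq (h.trans hC.ge)
  exact le_iSup₂_of_le δ ⟨hδ0, n, hn, C', hc, fun x hx y hy => hd x (hC' hx) y (hC' hy)⟩ le_rfl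

/-- Take `L` words of length `2 ^ L` whose columns run through all binary vectors: every ordered
pair shows `1, 0` in a quarter of the columns. -/
theorem quarter_le_maxFraction (L : ℕ) : ((1 / 4 : ℝ) : EReal) ≤ maxFraction L := by
  classical
  have hcard : Fintype.card (Fin L → Bool) = 2 ^ L := by simp
  let e : (Fin L → Bool) ≃ Fin (2 ^ L) := Fintype.equivFinOfCardEq hcard
  let x : Fin L → Fin (2 ^ L) → Bool := fun i c => e.symm c i
  have hD : ∀ i j, i ≠ j → 2 ^ L ≤ Delta (x i) (x j) * 4 := by
    intro i j hij
    have h1 : Fintype.card (Fin L → Bool) ≤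
        #((univ.filter fun c => x i c = true ∧ x j c = false) ×ˢ
          (univ : Finset (Bool × Bool))) := by
      rw [← card_univ]
      refine card_le_card_of_injOn (fun k =>
        (e (Function.update (Function.update k i true) j false), (k i, k j))) ?_ ?_
      · intro k _
        simp [x, hij]
      · intro k _ k' _ h
        simp only [Prod.mk.injEq, EmbeddingLike.apply_eq_iff_eq] at h
        ext1 a
        by_cases haj : a = j
        · rw [haj]; exact h.2.2
        by_cases hai : a = i
        · rw [hai]; exact h.2.1
        · simpa [haj, hai] using congrFun h.1 a
    rw [hcard, card_product] at h1
    simpa [Delta] using h1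
  have hinj : Function.Injective x := by
    intro i j hij
    by_contra hne
    have h1 := hD i j hne
    rw [hij] at h1
    have h2 : Delta (x j) (x j) = 0 := by simp [Delta]
    rw [h2, zero_mul] at h1
    exact absurd h1 (not_le.2 (by positivity))
  refine le_iSup₂_of_le (1 / 4) ⟨by norm_num, 2 ^ L, by positivity, univ.image x, ?_, ?_⟩ le_rfl
  · rw [card_image_of_injective _ hinj]; simp
  · intro a ha b hb hab
    obtain ⟨i, -, rfl⟩ := mem_image.1 ha
    obtain ⟨j, -, rfl⟩ := mem_image.1 hb
    have h1 := hD i j fun h => hab (h ▸ rfl)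
    have h2 : 2 ^ L ≤ 2 * asymDist (x i) (x j) := by
      have := le_max_left (Delta (x i) (x j)) (Delta (x j) (x i))
      rw [asymDist]; omega
    have h2' : ((2 ^ L : ℕ) : ℝ) ≤ 2 * asymDist (x i) (x j) := by exact_mod_cast h2
    linarith

theorem eventually_hasCode_of_lt_maxFraction {L : ℕ} {y : ℝ} (hy : (y : EReal) < maxFraction L)
    {N r : ℕ → ℕ} (hN : Tendsto N atTop atTop)
    (hr : Tendsto (fun j => (r j : ℝ) / N j) atTop (𝓝 y)) :
    ∀ᶠ j in atTop, HasCode (N j) L (r j) := by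
  classical
  obtain ⟨δ, hδ⟩ := lt_iSup_iff.1 hy
  obtain ⟨⟨hδ0, n₀, hn₀, C, hC, hd⟩, hyδ⟩ := lt_iSup_iff.1 hδ
  have hyδ' : y < δ := EReal.coe_lt_coe_iff.1 hyδ
  have hn₀' : (0 : ℝ) < n₀ := by exact_mod_cast hn₀
  have hNr : Tendsto (fun j => (N j : ℝ)) atTop atTop := tendsto_natCast_atTop_atTop.comp hN
  have hlim : Tendsto (fun j => (1 - (n₀ : ℝ) / N j) * δ) atTop (𝓝 ((1 - 0) * δ)) :=
    (tendsto_const_nhds.sub (hNr.const_div_atTop _)).mul_const _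
  have hev := hr.eventually_lt hlim (by linarith)
  filter_upwards [hev, hNr.eventually_gt_atTop 0] with j hj hj0
  refine hasCode_of_repeat (d := ⌈(n₀ : ℝ) * δ⌉₊) (C.image support) ?_ ?_ ?_
  · rw [card_image_of_injective _ (support_injective _), hC]
  · intro A hA B hB hAB
    obtain ⟨a, ha, rfl⟩ := mem_image.1 hA
    obtain ⟨b, hb, rfl⟩ := mem_image.1 hB
    have := hd a ha b hb fun h => hAB (h ▸ rfl)
    rw [asymDist, Delta_eq_card_sdiff, Delta_eq_card_sdiff] at this
    refine Nat.ceil_le.2 ?_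
    push_cast at this ⊢
    linarith
  · have h1 : (N j : ℝ) - n₀ ≤ ((N j / n₀ : ℕ) : ℝ) * n₀ := by
      have := Nat.lt_div_mul_add (a := N j) hn₀
      have : N j ≤ N j / n₀ * n₀ + n₀ := this.le
      have : (N j : ℝ) ≤ (N j / n₀ : ℕ) * n₀ + n₀ := by exact_mod_cast this
      linarith
    have h2 : (r j : ℝ) < ((N j : ℝ) - n₀) * δ := by
      rw [div_lt_iff₀ hj0] at hj
      calc (r j : ℝ) < _ := hj
        _ = _ := by field_simp
    have h3 : (r j : ℝ) < ((N j / n₀ : ℕ) : ℝ) * ⌈(n₀ : ℝ) * δ⌉₊ := by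
      calc (r j : ℝ) < ((N j : ℝ) - n₀) * δ := h2
        _ ≤ ((N j / n₀ : ℕ) : ℝ) * n₀ * δ := by gcongr
        _ = ((N j / n₀ : ℕ) : ℝ) * (n₀ * δ) := by ring
        _ ≤ _ := by gcongr; exact Nat.le_ceil _
    exact_mod_cast h3

/-! ### Strict inequalities extracted from condition (*). -/

/-- The Johnson radius `(1 - √(1 - 4 T / ν)) / 2`. -/
noncomputable def johnsonRadius (T ν : ℝ) : ℝ := (1 - Real.sqrt (1 - 4 * T / ν)) / 2

theorem johnsonRadius_le_half (T ν : ℝ) : johnsonRadius T ν ≤ 1 / 2 := by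
  have := Real.sqrt_nonneg (1 - 4 * T / ν)
  rw [johnsonRadius]; linarith

theorem johnsonRadius_nonneg {T ν : ℝ} (hT : 0 ≤ T) (hν : 0 < ν) : 0 ≤ johnsonRadius T ν := by
  have h : Real.sqrt (1 - 4 * T / ν) ≤ 1 := by
    rw [Real.sqrt_le_one]
    have : 0 ≤ 4 * T / ν := by positivity
    linarith
  rw [johnsonRadius]; linarith

theorem johnsonRadius_mul_le (T ν : ℝ) :
    johnsonRadius T ν * (1 - johnsonRadius T ν) ≤ T / ν := by
  have h : 1 - 4 * T / ν ≤ Real.sqrt (1 - 4 * T / ν) ^ 2 := by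
    rcases le_total 0 (1 - 4 * T / ν) with h | h
    · rw [Real.sq_sqrt h]
    · exact h.trans (sq_nonneg _)
  have e : johnsonRadius T ν * (1 - johnsonRadius T ν) =
      (1 - Real.sqrt (1 - 4 * T / ν) ^ 2) / 4 := by rw [johnsonRadius]; ring
  have e2 : 4 * T / ν = 4 * (T / ν) := by ring
  rw [e]; linarith

/-- Entropy increases strictly on `[0, 1/2]`. At radius `1/2` the truncated root could make both
radii equal, hence the hypothesis `h`. -/
theorem binEntropy_johnsonRadius_lt {T T' ν : ℝ} (hT : 0 ≤ T) (hTT' : T < T') (hν : 0 < ν)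
    (h : johnsonRadius T' ν ≠ 1 / 2) :
    Real.binEntropy (johnsonRadius T ν) < Real.binEntropy (johnsonRadius T' ν) := by
  have h0 : 0 < 1 - 4 * T' / ν := by
    by_contra hc
    exact h (by rw [johnsonRadius, Real.sqrt_eq_zero_of_nonpos (not_lt.1 hc)]; norm_num)
  have h1 : 4 * T / ν < 4 * T' / ν := by gcongr
  have h2 := Real.sqrt_lt_sqrt h0.le (by linarith : 1 - 4 * T' / ν < 1 - 4 * T / ν)
  refine Real.binEntropy_strictMonoOn ⟨johnsonRadius_nonneg hT hν, ?_⟩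
    ⟨johnsonRadius_nonneg (hT.trans hTT'.le) hν, ?_⟩ ?_
  · simpa using johnsonRadius_le_half T ν
  · simpa using johnsonRadius_le_half T' ν
  · rw [johnsonRadius, johnsonRadius]; linarith

/-- The second-stage error fraction after a fraction `x` of errors in the first stage. -/
noncomputable def residual (τ α x : ℝ) : ℝ := (τ - α * x) / (1 - α)

theorem residual_strictAnti {τ α : ℝ} (h0 : 0 < α) (h1 : α < 1) :
    StrictAnti (residual τ α) := by
  intro x y h
  have : 0 < 1 - α := by linarith
  unfold residual
  gcongr

theorem continuous_residual (τ α : ℝ) : Continuous (residual τ α) := by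
  unfold residual
  fun_prop

/-- Condition (*) is applied at some `x'` slightly below `x`, where the residual is strictly larger;
this also covers the endpoints of the range of `x`. Taking the first `l` with `x' ≤ tauStar R l ω`
avoids monotonicity of `tauStar` in `l`. If there is none, the second clause bounds the residual by
`1/4`. -/
theorem residual_lt_maxFraction {τ ω α R x : ℝ} {Lup L : ℕ} (h0 : 0 < α) (h1 : α < 1)
    (hadm : Admissible τ Lup ω α R) (hx0 : 0 < x) (hxω : x ≤ ω) (hxτ : α * x ≤ τ)
    (hL : 2 ≤ L) (hLup : L ≤ Lup) (hT : ∀ l ∈ Icc 1 (L - 1), tauStar R l ω < x) :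
    (residual τ α x : EReal) < maxFraction L := by
  have hev : ∀ᶠ x' in 𝓝[<] x, 0 < x' ∧ (∀ l ∈ Icc 1 (L - 1), tauStar R l ω < x') ∧ x' < x := by
    refine ((eventually_gt_nhds hx0).filter_mono nhdsWithin_le_nhds).and (Eventually.and ?_
      self_mem_nhdsWithin)
    exact (eventually_all_finset _).2 fun l hl =>
      (eventually_gt_nhds (hT l hl)).filter_mono nhdsWithin_le_nhds
  obtain ⟨x', hx'0, hx'T, hx'⟩ := hev.exists
  have hcond := hadm x' hx'0 (hx'.trans_le hxω)
    ((mul_lt_mul_of_pos_left hx' h0).trans_le hxτ)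
  have hlt : (residual τ α x : EReal) < (residual τ α x' : EReal) :=
    EReal.coe_lt_coe_iff.2 (residual_strictAnti h0 h1 hx')
  refine hlt.trans_le ?_
  by_cases hex : ∃ l, l ∈ Icc 1 Lup ∧ x' ≤ tauStar R l ω
  · classical
    obtain ⟨hl, hle⟩ := Nat.find_spec hex
    set l := Nat.find hex with hldef
    have hlL : L ≤ l := by
      by_contra hc
      have := hx'T l (by simp only [mem_Icc] at hl ⊢; omega)
      linarith
    have hprev : tauStar R (l - 1) ω ≤ x' := by
      have := Nat.find_min hex (m := l - 1) (by omega)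
      rw [mem_Icc] at this hl
      by_contra hc
      exact this ⟨⟨by omega, by omega⟩, (not_le.1 hc).le⟩
    exact (hcond.1 l hl hprev hle).trans (maxFraction_antitone hlL)
  · have : tauStar R Lup ω ≤ x' := by
      by_contra hc
      exact hex ⟨Lup, by simp; omega, (not_le.1 hc).le⟩
    refine le_trans ?_ (quarter_le_maxFraction L)
    exact EReal.coe_le_coe_iff.2 ((hcond.2 this).trans (tauStar_half_le _))

/-- The second clause of (*) passes to `x` by continuity from the left as a weak inequality; `T' >
tauStar R 1 ω` makes it strict. If the entropy difference is nonpositive, a residual below `1/4`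
still makes the right side positive. -/
theorem residual_and_rate_of_tauStar_lt {τ ω α R x T' : ℝ} {Lup : ℕ} (h0 : 0 < α) (h1 : α < 1)
    (hω0 : 0 ≤ ω) (hω1 : ω ≤ 1) (hadm : Admissible τ Lup ω α R) (hxω : x ≤ ω) (hxτ : α * x ≤ τ)
    (hT : tauStar R Lup ω < x) (hT' : tauStar R 1 ω < T') :
    residual τ α x < 1 / 4 ∧
      max 0 (α * (1 - ω + x) * (Real.binEntropy (x / (1 - ω + x)) -
        Real.binEntropy (johnsonRadius T' (1 - ω + x)))) <
      (1 - α) * (Real.log 2 - Real.binEntropy (2 * residual τ α x)) := by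
  have hlog : 0 < Real.log 2 := Real.log_pos (by norm_num)
  have hT0 := tauStar_nonneg R 1 hω0 hω1
  have hx0 : 0 < x := (tauStar_nonneg R Lup hω0 hω1).trans_lt hT
  have hν : 0 < 1 - ω + x := by linarith
  have hα : 0 < 1 - α := by linarith
  have hy0 : 0 ≤ residual τ α x := by
    rw [residual]; exact div_nonneg (by linarith) hα.le
  have hcond : ∀ x' ∈ Set.Ioo (tauStar R Lup ω) x, residual τ α x' ≤ 1 / 4 ∧
      Real.binEntropy (2 * residual τ α x') ≤ (1 - secondRate α x' ω R) * Real.log 2 := by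
    intro x' hx'
    have h2 := (hadm x' ((tauStar_nonneg R Lup hω0 hω1).trans_lt hx'.1) (hx'.2.trans_le hxω)
      ((mul_lt_mul_of_pos_left hx'.2 h0).trans_le hxτ)).2 hx'.1.le
    exact ⟨h2.trans (tauStar_half_le _), binEntropy_le_of_le_tauStar
      (hy0.trans_lt (residual_strictAnti h0 h1 hx'.2)) h2⟩
  have hy : residual τ α x < 1 / 4 := by
    obtain ⟨x', hx'⟩ := exists_between hT
    exact (residual_strictAnti h0 h1 hx'.2).trans_le (hcond x' hx').1
  refine ⟨hy, ?_⟩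
  have hlim1 : Tendsto (fun x' => Real.binEntropy (2 * residual τ α x')) (𝓝[<] x)
      (𝓝 (Real.binEntropy (2 * residual τ α x))) := by
    have : Continuous fun x' => Real.binEntropy (2 * residual τ α x') :=
      Real.binEntropy_continuous.comp ((continuous_residual τ α).const_mul 2)
    exact (this.tendsto x).mono_left nhdsWithin_le_nhds
  have hlim2 : Tendsto (fun x' => (1 - secondRate α x' ω R) * Real.log 2) (𝓝[<] x)
      (𝓝 ((1 - secondRate α x ω R) * Real.log 2)) := by
    have hH : Continuous entropy := Real.binEntropy_continuous.div_const _
    have hc : ContinuousAt (fun x' => 1 - ω + x') x := by fun_prop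
    have : ContinuousAt (fun x' => (1 - secondRate α x' ω R) * Real.log 2) x := by
      unfold secondRate
      have hc1 : ContinuousAt (fun x' => entropy (x' / (1 - ω + x'))) x :=
        hH.continuousAt.comp (continuousAt_id.div hc hν.ne')
      have hc2 : ContinuousAt (fun x' => entropy ((1 - Real.sqrt (1 - 4 * tauStar R 1 ω /
          (1 - ω + x'))) / 2)) x :=
        hH.continuousAt.comp ((continuousAt_const.sub (Real.continuous_sqrt.continuousAt.comp
          (continuousAt_const.sub (continuousAt_const.div hc hν.ne')))).div_const 2)
      exact (continuousAt_const.sub (((continuousAt_const.mul hc).div_const _).mul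
        (hc1.sub hc2))).mul_const _
    exact this.tendsto.mono_left nhdsWithin_le_nhds
  have hle := le_of_tendsto_of_tendsto hlim1 hlim2 (by
    filter_upwards [Ioo_mem_nhdsLT hT] with x' hx' using (hcond x' hx').2)
  have hrate : (1 - α) * (secondRate α x ω R * Real.log 2) =
      α * (1 - ω + x) * (Real.binEntropy (x / (1 - ω + x)) -
        Real.binEntropy (johnsonRadius (tauStar R 1 ω) (1 - ω + x))) := by
    rw [secondRate, entropy, entropy, johnsonRadius]
    field_simp
  have hpos : 0 < Real.log 2 - Real.binEntropy (2 * residual τ α x) := by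
    rw [sub_pos, Real.binEntropy_lt_log_two]
    norm_num
    linarith
  refine max_lt (mul_pos hα hpos) ?_
  rcases le_or_gt (Real.binEntropy (x / (1 - ω + x)) -
      Real.binEntropy (johnsonRadius T' (1 - ω + x))) 0 with h | h
  · exact (mul_nonpos_of_nonneg_of_nonpos (by positivity) h).trans_lt (mul_pos hα hpos)
  · have hne : johnsonRadius T' (1 - ω + x) ≠ 1 / 2 := by
      intro he
      rw [he, one_div, Real.binEntropy_two_inv] at h
      have := Real.binEntropy_le_log_two (p := x / (1 - ω + x))
      linarith
    have hlt := binEntropy_johnsonRadius_lt hT0 hT' hν hne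
    calc _ < α * (1 - ω + x) * (Real.binEntropy (x / (1 - ω + x)) -
        Real.binEntropy (johnsonRadius (tauStar R 1 ω) (1 - ω + x))) := by gcongr
      _ = (1 - α) * (secondRate α x ω R * Real.log 2) := hrate.symm
      _ ≤ _ := by gcongr; linarith

/-! ### Solvability of the second stage for long codes. -/

theorem HasCode.mono {n K K' r : ℕ} (h : HasCode n K r) (hK : K' ≤ K) : HasCode n K' r := by
  obtain ⟨C, hC, hd⟩ := h
  exact ⟨C, hK.trans hC, hd⟩

theorem ceil_mul_le {α : ℝ} (h1 : α ≤ 1) (n : ℕ) : ⌈α * n⌉₊ ≤ n :=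
  Nat.ceil_le.2 (by nlinarith [Nat.cast_nonneg (α := ℝ) n])

theorem tendsto_ceil_div {α : ℝ} (h : 0 ≤ α) {n : ℕ → ℕ} (hn : Tendsto n atTop atTop) :
    Tendsto (fun j => ((⌈α * n j⌉₊ : ℕ) : ℝ) / n j) atTop (𝓝 α) :=
  (tendsto_nat_ceil_mul_div_atTop h).comp (tendsto_natCast_atTop_atTop.comp hn)

theorem tendsto_ceil_atTop {α : ℝ} (h : 0 < α) {n : ℕ → ℕ} (hn : Tendsto n atTop atTop) :
    Tendsto (fun j => ⌈α * n j⌉₊) atTop atTop :=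
  tendsto_nat_ceil_atTop.comp ((tendsto_natCast_atTop_atTop.comp hn).const_mul_atTop h)

theorem tendsto_sub_ceil_div {α : ℝ} (h0 : 0 ≤ α) (h1 : α ≤ 1) {n : ℕ → ℕ}
    (hn : Tendsto n atTop atTop) :
    Tendsto (fun j => ((n j - ⌈α * n j⌉₊ : ℕ) : ℝ) / n j) atTop (𝓝 (1 - α)) := by
  refine ((tendsto_ceil_div h0 hn).const_sub 1).congr' ?_
  filter_upwards [hn.eventually_gt_atTop 0] with j hj
  have : (0 : ℝ) < n j := by exact_mod_cast hj
  rw [Nat.cast_sub (ceil_mul_le h1 _), sub_div, div_self this.ne']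

theorem tendsto_sub_ceil_atTop {α : ℝ} (h0 : 0 ≤ α) (h1 : α < 1) {n : ℕ → ℕ}
    (hn : Tendsto n atTop atTop) : Tendsto (fun j => n j - ⌈α * n j⌉₊) atTop atTop := by
  have hn' : Tendsto (fun j => (n j : ℝ)) atTop atTop := tendsto_natCast_atTop_atTop.comp hn
  refine tendsto_natCast_atTop_iff (R := ℝ).1 ?_
  refine ((tendsto_sub_ceil_div h0 h1.le hn).pos_mul_atTop (by linarith) hn').congr' ?_
  filter_upwards [hn'.eventually_gt_atTop 0] with j hj
  field_simp

/-- For all spread first-stage codes, the second stage can resolve the ambiguity left by `e` errors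
in the first one. -/
def SecondStageSolvable (τ α ω : ℝ) (ρ : ℕ → ℝ) (Lup n e : ℕ) : Prop :=
  ∀ C : Finset (Finset (Fin ⌈α * n⌉₊)), (∀ A ∈ C, #A = ⌊ω * ⌈α * n⌉₊⌋₊) →
    (∀ l ∈ Icc 1 Lup, Spread C ⌊ω * ⌈α * n⌉₊⌋₊ l (ρ l * ⌈α * n⌉₊)) →
    ∀ Y : Finset (Fin ⌈α * n⌉₊), #Y ≤ ⌊ω * ⌈α * n⌉₊⌋₊ → ⌊ω * ⌈α * n⌉₊⌋₊ - #Y = e →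
      HasCode (n - ⌈α * n⌉₊) #{A ∈ C | Y ⊆ A} (⌊τ * n⌋₊ - e)

section Limits

variable {τ α ω x : ℝ} {ρ : ℕ → ℝ} {Lup : ℕ} {n e : ℕ → ℕ}

theorem tendsto_residual (hτ : 0 ≤ τ) (h0 : 0 < α) (h1 : α < 1) (hn : Tendsto n atTop atTop)
    (hx : Tendsto (fun j => (e j : ℝ) / (⌈α * n j⌉₊ : ℕ)) atTop (𝓝 x))
    (het : ∀ j, e j ≤ ⌊τ * n j⌋₊) :
    Tendsto (fun j => ((⌊τ * n j⌋₊ - e j : ℕ) : ℝ) / (n j - ⌈α * n j⌉₊ : ℕ)) atTop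
      (𝓝 (residual τ α x)) := by
  have hlim : Tendsto (fun j => (((⌊τ * n j⌋₊ : ℕ) : ℝ) / n j -
      ((⌈α * n j⌉₊ : ℕ) : ℝ) / n j * ((e j : ℝ) / (⌈α * n j⌉₊ : ℕ))) /
      (((n j - ⌈α * n j⌉₊ : ℕ) : ℝ) / n j)) atTop (𝓝 (residual τ α x)) :=
    (((tendsto_floor_div hτ).comp hn).sub ((tendsto_ceil_div h0.le hn).mul hx)).div
      (tendsto_sub_ceil_div h0.le h1.le hn) (by linarith)
  refine hlim.congr' ?_
  filter_upwards [hn.eventually_gt_atTop 0, (tendsto_ceil_atTop h0 hn).eventually_gt_atTop 0,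
    (tendsto_sub_ceil_atTop h0.le h1 hn).eventually_gt_atTop 0] with j hj hj1 hj2
  have h3 : (0 : ℝ) < n j := by exact_mod_cast hj
  have h4 : (0 : ℝ) < (⌈α * n j⌉₊ : ℕ) := by exact_mod_cast hj1
  have h5 : (0 : ℝ) < (n j - ⌈α * n j⌉₊ : ℕ) := by exact_mod_cast hj2
  rw [Nat.cast_sub (het j)]
  field_simp

theorem eventually_solvable_of_lt_maxFraction (hτ : 0 ≤ τ) (h0 : 0 < α) (h1 : α < 1)
    (hn : Tendsto n atTop atTop)
    (hx : Tendsto (fun j => (e j : ℝ) / (⌈α * n j⌉₊ : ℕ)) atTop (𝓝 x))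
    (het : ∀ j, e j ≤ ⌊τ * n j⌋₊) {L : ℕ} (hL : L ∈ Icc 1 Lup) (hxL : x < ρ L)
    (hy : L = 1 ∨ (residual τ α x : EReal) < maxFraction L) :
    ∀ᶠ j in atTop, SecondStageSolvable τ α ω ρ Lup (n j) (e j) := by
  have hcode : ∀ᶠ j in atTop, HasCode (n j - ⌈α * n j⌉₊) L (⌊τ * n j⌋₊ - e j) := by
    rcases hy with rfl | hy
    · exact Eventually.of_forall fun j => hasCode_of_le_one _ le_rfl
    · exact eventually_hasCode_of_lt_maxFraction hy (tendsto_sub_ceil_atTop h0.le h1 hn)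
        (tendsto_residual hτ h0 h1 hn hx het)
  filter_upwards [hcode, hx.eventually_lt_const hxL,
    (tendsto_ceil_atTop h0 hn).eventually_gt_atTop 0] with j hj hjx hj1 C hw hC Y hY hYe
  have h4 : (0 : ℝ) < (⌈α * n j⌉₊ : ℕ) := by exact_mod_cast hj1
  refine hj.mono ((hC L hL).card_list_le Y ?_)
  rw [div_lt_iff₀ h4] at hjx
  have : ((⌊ω * ⌈α * n j⌉₊⌋₊ : ℕ) : ℝ) = e j + #Y := by
    rw [← hYe, Nat.cast_sub hY]; ring
  linarith

theorem eventually_solvable_of_rate_lt (hτ : 0 ≤ τ) (h0 : 0 < α) (h1 : α < 1) (hω0 : 0 ≤ ω)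
    (hω1 : ω ≤ 1) (hn : Tendsto n atTop atTop)
    (hx : Tendsto (fun j => (e j : ℝ) / (⌈α * n j⌉₊ : ℕ)) atTop (𝓝 x))
    (het : ∀ j, e j ≤ ⌊τ * n j⌋₊) (hLup : 0 < Lup)
    (hν : 0 < 1 - ω + x) {T : ℝ} (hT0 : 0 ≤ T) (hT : T < ρ 1) (hy0 : 0 ≤ residual τ α x)
    (hy : residual τ α x < 1 / 4)
    (hrate : max 0 (α * (1 - ω + x) * (Real.binEntropy (x / (1 - ω + x)) -
        Real.binEntropy (johnsonRadius T (1 - ω + x)))) <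
      (1 - α) * (Real.log 2 - Real.binEntropy (2 * residual τ α x))) :
    ∀ᶠ j in atTop, SecondStageSolvable τ α ω ρ Lup (n j) (e j) := by
  set ν := 1 - ω + x with hνdef
  set y := residual τ α x
  set r := johnsonRadius T ν
  have hr0 : 0 ≤ r := johnsonRadius_nonneg hT0 hν
  have hr1 : r ≤ 1 / 2 := johnsonRadius_le_half T ν
  -- The Gilbert–Varshamov parameter is taken slightly above `2 y` to absorb rounding.
  obtain ⟨p, hp0, hp1, hpy, hp⟩ : ∃ p : ℝ, 0 < p ∧ p ≤ 1 / 2 ∧ 2 * y < p ∧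
      max 0 (α * ν * (Real.binEntropy (x / ν) - Real.binEntropy r)) <
        (1 - α) * (Real.log 2 - Real.binEntropy p) := by
    have hc : Continuous fun p => (1 - α) * (Real.log 2 - Real.binEntropy p) := by fun_prop
    have h3 := ((hc.tendsto (2 * y)).mono_left
      (nhdsWithin_le_nhds (s := Set.Ioi (2 * y)))).eventually_const_lt hrate
    have h4 : ∀ᶠ p in 𝓝[>] (2 * y), p < 1 / 2 :=
      (eventually_lt_nhds (by linarith)).filter_mono nhdsWithin_le_nhds
    obtain ⟨p, h5, h6, h7⟩ := (h3.and (h4.and self_mem_nhdsWithin)).exists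
    have h7' : 2 * y < p := h7
    exact ⟨p, by linarith, h6.le, h7', h5⟩
  set n₁ : ℕ → ℕ := fun j => ⌈α * n j⌉₊ with hn₁
  set w : ℕ → ℕ := fun j => ⌊ω * n₁ j⌋₊ with hw
  -- The number of positions outside `Y`, hence the length of the punctured list code.
  set N : ℕ → ℕ := fun j => n₁ j - w j + e j with hN
  have hwn : ∀ j, w j ≤ n₁ j := fun j => floor_mul_le hω1 _
  have hn₁top : Tendsto n₁ atTop atTop := tendsto_ceil_atTop h0 hn
  have hn' : Tendsto (fun j => (n j : ℝ)) atTop atTop := tendsto_natCast_atTop_atTop.comp hn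
  have hn₁' : Tendsto (fun j => (n₁ j : ℝ)) atTop atTop := tendsto_natCast_atTop_atTop.comp hn₁top
  have hn₁n : Tendsto (fun j => (n₁ j : ℝ) / n j) atTop (𝓝 α) := tendsto_ceil_div h0.le hn
  have hNn₁ : Tendsto (fun j => (N j : ℝ) / n₁ j) atTop (𝓝 ν) := by
    have hwlim : Tendsto (fun j => (w j : ℝ) / n₁ j) atTop (𝓝 ω) :=
      (tendsto_floor_div hω0).comp hn₁top
    refine ((hwlim.const_sub 1).add hx).congr' ?_
    filter_upwards [hn₁'.eventually_gt_atTop 0] with j hj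
    simp only [hN]
    rw [Nat.cast_add, Nat.cast_sub (hwn j)]
    change 1 - (w j : ℝ) / n₁ j + (e j : ℝ) / n₁ j = _
    field_simp
  have hN' : Tendsto (fun j => (N j : ℝ)) atTop atTop := by
    refine (hNn₁.pos_mul_atTop hν hn₁').congr' ?_
    filter_upwards [hn₁'.eventually_gt_atTop 0] with j hj
    field_simp
  have hNn : Tendsto (fun j => (N j : ℝ) / n j) atTop (𝓝 (α * ν)) := by
    refine (hn₁n.mul hNn₁).congr' ?_
    filter_upwards [hn₁'.eventually_gt_atTop 0] with j hj
    field_simp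
  have heN : Tendsto (fun j => (e j : ℝ) / N j) atTop (𝓝 (x / ν)) := by
    refine (hx.div hNn₁ hν.ne').congr' ?_
    filter_upwards [hn₁'.eventually_gt_atTop 0, hN'.eventually_gt_atTop 0] with j hj hj'
    change (e j : ℝ) / n₁ j / (N j / n₁ j) = e j / N j
    field_simp
  set m : ℕ → ℕ := fun j => ⌊r * N j⌋₊ with hm
  have hmN : Tendsto (fun j => (m j : ℝ) / N j) atTop (𝓝 r) :=
    (tendsto_nat_floor_mul_div_atTop hr0).comp hN'
  -- Johnson's condition holds with room to spare in the limit: `r (1 - r) ≤ T / ν < ρ 1 / ν`.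
  have hJ : ∀ᶠ j in atTop, (m j : ℝ) * (N j - m j) < ρ 1 * n₁ j * N j := by
    have hlim1 : Tendsto (fun j => (m j : ℝ) / N j * (1 - (m j : ℝ) / N j)) atTop
        (𝓝 (r * (1 - r))) := hmN.mul (hmN.const_sub 1)
    have hlim2 : Tendsto (fun j => ρ 1 / ((N j : ℝ) / n₁ j)) atTop (𝓝 (ρ 1 / ν)) :=
      tendsto_const_nhds.div hNn₁ hν.ne'
    have hlt : r * (1 - r) < ρ 1 / ν :=
      (johnsonRadius_mul_le T ν).trans_lt (by gcongr)
    filter_upwards [hlim1.eventually_lt hlim2 hlt, hn₁'.eventually_gt_atTop 0,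
      hN'.eventually_gt_atTop 0] with j hj hj1 hj2
    have h3 := mul_lt_mul_of_pos_right hj (mul_pos hj2 hj2)
    calc (m j : ℝ) * (N j - m j) = (m j : ℝ) / N j * (1 - (m j : ℝ) / N j) * (N j * N j) := by
          field_simp
      _ < _ := h3
      _ = _ := by field_simp
  have hexp : ∀ᶠ j in atTop, 4 * Real.log (n j + 1) + N j * max 0 (Real.binEntropy (e j / N j) -
      Real.binEntropy (m j / N j)) ≤
      ((n j - n₁ j : ℕ) : ℝ) * (Real.log 2 - Real.binEntropy p) := by
    have hlim1 : Tendsto (fun j => 4 * (Real.log (n j + 1) / n j) + (N j : ℝ) / n j *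
        max 0 (Real.binEntropy (e j / N j) - Real.binEntropy (m j / N j))) atTop
        (𝓝 (4 * 0 + α * ν * max 0 (Real.binEntropy (x / ν) - Real.binEntropy r))) := by
      refine ((tendsto_log_succ_div.comp hn).const_mul 4).add (hNn.mul (tendsto_const_nhds.max ?_))
      exact ((Real.binEntropy_continuous.tendsto _).comp heN).sub
        ((Real.binEntropy_continuous.tendsto _).comp hmN)
    have hlim2 : Tendsto (fun j => ((n j - n₁ j : ℕ) : ℝ) / n j *
        (Real.log 2 - Real.binEntropy p)) atTop
        (𝓝 ((1 - α) * (Real.log 2 - Real.binEntropy p))) :=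
      (tendsto_sub_ceil_div h0.le h1.le hn).mul_const _
    have hlt : 4 * 0 + α * ν * max 0 (Real.binEntropy (x / ν) - Real.binEntropy r) <
        (1 - α) * (Real.log 2 - Real.binEntropy p) := by
      rw [mul_zero, zero_add, mul_max_of_nonneg _ _ (by positivity : 0 ≤ α * ν), mul_zero]
      exact hp
    filter_upwards [hlim1.eventually_lt hlim2 hlt, hn'.eventually_gt_atTop 0] with j hj hj1
    have h3 := (mul_lt_mul_of_pos_right hj hj1).le
    calc _ = (4 * (Real.log (n j + 1) / n j) + (N j : ℝ) / n j *
        max 0 (Real.binEntropy (e j / N j) - Real.binEntropy (m j / N j))) * n j := by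
          field_simp
      _ ≤ _ := h3
      _ = _ := by field_simp
  have hry : ∀ᶠ j in atTop, 2 * ((⌊τ * n j⌋₊ - e j : ℕ) : ℝ) ≤ p * (n j - n₁ j : ℕ) := by
    have := tendsto_residual hτ h0 h1 hn hx het
    filter_upwards [this.eventually_lt_const (show y < p / 2 by linarith),
      (tendsto_sub_ceil_atTop h0.le h1 hn).eventually_gt_atTop 0] with j hj hj1
    have h5 : (0 : ℝ) < (n j - ⌈α * n j⌉₊ : ℕ) := by exact_mod_cast hj1
    rw [div_lt_iff₀ h5] at hj
    change 2 * ((⌊τ * n j⌋₊ - e j : ℕ) : ℝ) ≤ p * (n j - ⌈α * n j⌉₊ : ℕ)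
    linarith
  filter_upwards [hJ, hexp, hry] with j hJ hexp hry C hCw hC Y hY hYe
  have hYn : #Y ≤ n₁ j := (card_le_univ _).trans (by simp [n₁])
  have hwj := hwn j
  have hYw : #Y ≤ w j := hY
  have hYe' : w j - #Y = e j := hYe
  have hNj : N j = n₁ j - w j + e j := rfl
  have hNY : N j + #Y = ⌈α * n j⌉₊ := by
    change N j + #Y = n₁ j
    omega
  have hlist := (hC 1 (by simp; omega)).card_list_le_exp hCw Y (m := m j) hNY (by omega) (by
    have : (m j : ℝ) ≤ r * N j := Nat.floor_le (by positivity)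
    have h3 : (m j : ℝ) ≤ 1 / 2 * N j := this.trans (by gcongr)
    have h4 : (2 : ℝ) * m j ≤ N j := by linarith
    exact_mod_cast h4) hJ
  refine hasCode_of_le_exp hp0 hp1 hry (hlist.trans ?_)
  have hNle : (N j : ℝ) ≤ n j := by
    have h3 : n₁ j ≤ n j := ceil_mul_le h1.le _
    have h4 : N j + #Y = n₁ j := hNY
    exact_mod_cast (by omega : N j ≤ n j)
  have hYe2 : ⌊ω * (⌈α * n j⌉₊ : ℕ)⌋₊ - #Y = e j := hYe
  rw [hYe2]
  calc _ ≤ ((n j : ℝ) + 1) ^ 4 * Real.exp (N j *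
        max 0 (Real.binEntropy (e j / N j) - Real.binEntropy (m j / N j))) := by gcongr
    _ = Real.exp (4 * Real.log (n j + 1) + N j *
        max 0 (Real.binEntropy (e j / N j) - Real.binEntropy (m j / N j))) := by
      rw [Real.exp_add]
      congr 1
      have h3 := Real.exp_nat_mul (Real.log ((n j : ℝ) + 1)) 4
      rw [Real.exp_log (by positivity)] at h3
      exact_mod_cast h3.symm
    _ ≤ _ := Real.exp_le_exp.2 hexp

theorem eventually_solvable {R : ℝ} (hτ : 0 ≤ τ) (h0 : 0 < α) (h1 : α < 1) (hω0 : 0 ≤ ω)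
    (hω1 : ω ≤ 1) (hLup : 0 < Lup) (hadm : Admissible τ Lup ω α R)
    (hρ : ∀ l ∈ Icc 1 Lup, tauStar R l ω < ρ l) (hn : Tendsto n atTop atTop)
    (hx : Tendsto (fun j => (e j : ℝ) / (⌈α * n j⌉₊ : ℕ)) atTop (𝓝 x))
    (het : ∀ j, e j ≤ ⌊τ * n j⌋₊) (hew : ∀ j, e j ≤ ⌊ω * ⌈α * n j⌉₊⌋₊) :
    ∀ᶠ j in atTop, SecondStageSolvable τ α ω ρ Lup (n j) (e j) := by
  classical
  have hpos : ∀ᶠ j in atTop, (0 : ℝ) < (⌈α * n j⌉₊ : ℕ) :=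
    (tendsto_natCast_atTop_atTop.comp (tendsto_ceil_atTop h0 hn)).eventually_gt_atTop 0
  have hxω : x ≤ ω := by
    refine le_of_tendsto hx ?_
    filter_upwards [hpos] with j hj
    rw [div_le_iff₀ hj]
    exact (Nat.cast_le.2 (hew j)).trans (Nat.floor_le (by positivity))
  have hxτ : α * x ≤ τ := by
    refine le_of_tendsto (hx.const_mul α) ?_
    filter_upwards [hpos] with j hj
    rw [mul_div_assoc', div_le_iff₀ hj]
    calc α * (e j : ℝ) ≤ α * (τ * n j) := by
          gcongr; exact (Nat.cast_le.2 (het j)).trans (Nat.floor_le (by positivity))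
      _ = τ * (α * n j) := by ring
      _ ≤ _ := by gcongr; exact Nat.le_ceil _
  have h1mem : 1 ∈ Icc 1 Lup := by simp; omega
  have hTnn : ∀ l, 0 ≤ tauStar R l ω := fun l => tauStar_nonneg R l hω0 hω1
  by_cases hex : ∃ L, L ∈ Icc 1 Lup ∧ x < ρ L
  · obtain ⟨hL, hxL⟩ := Nat.find_spec hex
    have hmin : ∀ l ∈ Icc 1 (Nat.find hex - 1), tauStar R l ω < x := by
      intro l hl
      rw [mem_Icc] at hl hL
      have hl' : l ∈ Icc 1 Lup := mem_Icc.2 ⟨hl.1, by omega⟩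
      have := Nat.find_min hex (m := l) (by omega)
      exact (hρ l hl').trans_le (not_lt.1 fun h => this ⟨hl', h⟩)
    refine eventually_solvable_of_lt_maxFraction hτ h0 h1 hn hx het hL hxL ?_
    rcases Nat.lt_or_ge (Nat.find hex) 2 with h2 | h2
    · left
      have := (mem_Icc.1 hL).1
      omega
    · right
      have hx0 : 0 < x := (hTnn 1).trans_lt (hmin 1 (mem_Icc.2 ⟨le_rfl, by omega⟩))
      exact residual_lt_maxFraction h0 h1 hadm hx0 hxω hxτ h2 (mem_Icc.1 hL).2 hmin
  · have hge : ∀ l ∈ Icc 1 Lup, ρ l ≤ x := fun l hl => not_lt.1 fun h => hex ⟨l, hl, h⟩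
    have hLmem : Lup ∈ Icc 1 Lup := by simp; omega
    have hTx : tauStar R Lup ω < x := (hρ Lup hLmem).trans_le (hge Lup hLmem)
    have hx0 : 0 < x := (hTnn Lup).trans_lt hTx
    obtain ⟨T, hT1, hT2⟩ := exists_between (hρ 1 h1mem)
    obtain ⟨hy, hrate⟩ := residual_and_rate_of_tauStar_lt h0 h1 hω0 hω1 hadm hxω hxτ hTx hT1
    exact eventually_solvable_of_rate_lt hτ h0 h1 hω0 hω1 hn hx het hLup (by linarith)
      ((hTnn 1).trans hT1.le) hT2
      (by rw [residual]; exact div_nonneg (by linarith) (by linarith)) hy hrate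

end Limits

/-- Compactness: failures for arbitrarily large `n` would give a subsequence along which `e / n₁`
converges, and there `eventually_solvable` applies. -/
theorem eventually_forall_solvable {τ α ω R : ℝ} {ρ : ℕ → ℝ} {Lup : ℕ} (hτ : 0 ≤ τ) (h0 : 0 < α)
    (h1 : α < 1) (hω0 : 0 ≤ ω) (hω1 : ω ≤ 1) (hLup : 0 < Lup) (hadm : Admissible τ Lup ω α R)
    (hρ : ∀ l ∈ Icc 1 Lup, tauStar R l ω < ρ l) :
    ∀ᶠ n : ℕ in atTop, ∀ e, e ≤ ⌊τ * n⌋₊ → e ≤ ⌊ω * ⌈α * n⌉₊⌋₊ →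
      SecondStageSolvable τ α ω ρ Lup n e := by
  by_contra hcon
  obtain ⟨φ, hφ, hbad⟩ := extraction_of_frequently_atTop (not_eventually.1 hcon)
  push Not at hbad
  choose e het hew hbad using hbad
  have hmem : ∀ j, (e j : ℝ) / (⌈α * φ j⌉₊ : ℕ) ∈ Set.Icc (0 : ℝ) 1 := by
    intro j
    refine ⟨by positivity, div_le_one_of_le₀ ?_ (by positivity)⟩
    exact_mod_cast (hew j).trans (floor_mul_le hω1 _)
  obtain ⟨x, -, ψ, hψ, hx⟩ := isCompact_Icc.tendsto_subseq hmem
  have := eventually_solvable (n := fun j => φ (ψ j)) (e := fun j => e (ψ j)) hτ h0 h1 hω0 hω1 hLup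
    hadm hρ (hφ.tendsto_atTop.comp hψ.tendsto_atTop) hx (fun j => het _) (fun j => hew _)
  obtain ⟨j, hj⟩ := this.exists
  exact hbad (ψ j) hj

/-! ### The rate bound. -/

/-- Covers the degenerate cases `α = 0` and `R = 0`; should the maximum be 0, `log 0 = 0` keeps the
term nonnegative. -/
theorem twoStageRate_nonneg (τ : ℝ) : 0 ≤ twoStageRate τ := by
  refine le_limsup_of_frequently_le' (Eventually.frequently (Eventually.of_forall fun n => ?_))
  rw [← EReal.coe_zero, EReal.coe_le_coe_iff]
  refine div_nonneg (div_nonneg (Real.log_natCast_nonneg _) (Real.log_nonneg (by norm_num)))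
    (by positivity)

theorem mul_le_twoStageRate {τ α ω R R' : ℝ} {Lup : ℕ} (hτ : 0 ≤ τ) (h0 : 0 < α)
    (h1 : α < 1) (hω0 : 0 ≤ ω) (hω1 : ω ≤ 1) (hLup : 0 < Lup) (hadm : Admissible τ Lup ω α R)
    (hR'0 : 0 ≤ R') (hR' : R' < R) (hR : R ≤ entropy ω) :
    ((α * R' : ℝ) : EReal) ≤ twoStageRate τ := by
  have hlog : 0 < Real.log 2 := Real.log_pos (by norm_num)
  obtain ⟨ρ, hρ, hcode⟩ := exists_firstStage hLup hω0 hω1 hR'0 hR' hR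
  have hceil := tendsto_ceil_atTop (n := fun n => n) h0 tendsto_id
  refine le_limsup_of_frequently_le' (Eventually.frequently ?_)
  filter_upwards [hceil.eventually hcode, hceil.eventually_gt_atTop 1,
    (tendsto_sub_ceil_atTop (n := fun n => n) h0.le h1 tendsto_id).eventually_gt_atTop 0,
    eventually_forall_solvable hτ h0 h1 hω0 hω1 hLup hadm hρ, eventually_gt_atTop 0]
    with n hn hn1 hn2 hsol hn0
  obtain ⟨C, hCw, hCcard, hC⟩ := hn
  have hn' : (0 : ℝ) < n := by exact_mod_cast hn0
  have hCpos : (0 : ℝ) < #C := (Real.exp_pos _).trans_le hCcard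
  have hach : TwoStageAchievable ⌈α * n⌉₊ (n - ⌈α * n⌉₊) ⌊τ * n⌋₊ #C := by
    refine twoStageAchievable_of_hasCode C hCw (card_pos.1 (by exact_mod_cast hCpos)) ?_
    intro Y hY hYt
    exact hsol _ hYt (Nat.sub_le _ _) C hCw hC Y hY rfl
  have hmax : #C ≤ twoStageMax n ⌊τ * n⌋₊ :=
    le_csSup (bddAbove_twoStageSizes _ _) ⟨_, _, hn1, hn2, by omega, hach⟩
  rw [EReal.coe_le_coe_iff, le_div_iff₀ hn', Real.le_logb_iff_rpow_le (by norm_num)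
    (hCpos.trans_le (by exact_mod_cast hmax))]
  calc (2 : ℝ) ^ (α * R' * n) = Real.exp (α * n * (R' * Real.log 2)) := by
        rw [Real.rpow_def_of_pos (by norm_num)]; congr 1; ring
    _ ≤ Real.exp ((⌈α * n⌉₊ : ℕ) * (R' * Real.log 2)) := by
        gcongr; exact Nat.le_ceil _
    _ ≤ #C := hCcard
    _ ≤ _ := by exact_mod_cast hmax

end ZChannel

theorem mainTheorem3 (τ : ℝ) (hτ₀ : 0 < τ) (hτ₁ : τ < 1) (Lup : ℕ) (hLup : 0 < Lup) :
    (⨆ ω ∈ Set.Icc (0 : ℝ) 1, ⨆ α ∈ Set.Ico (0 : ℝ) 1,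
      ⨆ R ∈ {R : ℝ | 0 ≤ R ∧ R ≤ ZChannel.entropy ω ∧ ZChannel.Admissible τ Lup ω α R},
        ((α * R : ℝ) : EReal)) ≤ ZChannel.twoStageRate τ := by
  refine iSup₂_le fun ω hω => iSup₂_le fun α hα => iSup₂_le fun R hR => ?_
  obtain ⟨hR0, hRω, hadm⟩ := hR
  rcases hα.1.eq_or_lt with rfl | hα0
  · simpa using ZChannel.twoStageRate_nonneg τ
  rcases hR0.eq_or_lt with rfl | hR0
  · simpa using ZChannel.twoStageRate_nonneg τ
  -- The construction only reaches rates `R' < R`, so the value at `R` is a limit from the left.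
  have hlim : Filter.Tendsto (fun R' : ℝ => ((α * R' : ℝ) : EReal)) (nhdsWithin R (Set.Iio R))
      (nhds ((α * R : ℝ) : EReal)) := by
    have hc : Continuous fun R' : ℝ => ((α * R' : ℝ) : EReal) :=
      continuous_coe_real_ereal.comp (continuous_const.mul continuous_id)
    exact (hc.tendsto R).mono_left nhdsWithin_le_nhds
  refine le_of_tendsto hlim ?_
  filter_upwards [Ioo_mem_nhdsLT hR0] with R' hR'
  exact ZChannel.mul_le_twoStageRate hτ₀.le hα0 hα.2 hω.1 hω.2 hLup hadm hR'.1.le hR'.2 hRω
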